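/- **Setting.** A database instance $D$ gives every name of a finite set of relation names a finite relation over a domain; $|D|$ is its number of tuples. A conjunctive query (CQ) $q$ has a body of relational atoms, whose terms are variables or constants, and a finite set $\mathrm{head}(q)$ of variables of the body. For a finite set $\mathcal I$ of inequalities $x \neq y$ between variables of $q$, the query $(q,\mathcal I)$ returns the restrictions to $\mathrm{head}(q)$ of those answers of the full query $q^f$ (all variables in the head) that satisfy $\mathcal I$; let $k$ be the number of variables that appear in $\mathcal I$. A Select-Project-Join (SPJ) plan is an expression built from base relations, with pairwise distinct attribute names, by selections ($a=b$ or $a=c$ with $c$ a constant), projections and equijoins. It is a plan for $q$ if it computes $q$ and if, with each variable stored at an attribute, the projection-free expression left when all projections are pulled to the top computes $q^f$. Plans are executed operator by operator. Time is counted in elementary steps: reading or writing a tuple, one dictionary access, one comparison of two values, creation of one tree node, and one step of overhead per operator. For a bipartite graph $H$ with edges $E$ between the attributes of a relation $R$ outside $X$ and attributes not in $R$, the $H$-projection $\Pi^H_X(R)$ groups $R$ by the values at $X$ and keeps from each group a subset, as follows. The tuples $t$ of the group are scanned while a tree is maintained, at first a single leaf labelled $\bot^*$. A leaf labelled $\bot^*$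 carries the values $y_j=a_j$ written on its path from the root. If $t[x]=a_j$ for some edge $(x,y_j)\in E$ with $y_j$ on that path, the leaf is unchanged. Otherwise it receives the label $t$, and for every $(x,y)\in E$ with $y$ not on the path it gets a child labelled $\bot^*$, with $y=t[x]$ written on the edge. The tuples that label a node are kept, untruncated. **Transformation.** Let $\mathcal P_q$ be an SPJ plan for $q$, and read $\mathcal I$ as inequalities between the attributes at which the variables are stored. The plan $\mathcal P_{q,\mathcal I}$ is obtained from $\mathcal P_q$ as follows. Every projection $\Pi_X$ applied to a subplan whose base relations have the attributes $Z$ is replaced by $\Pi_X^H$, where $H$ has as edges the inequalities of $\mathcal I$ between $Z\setminus X$ and attributes outside $Z$. Every inequality of $\mathcal I$ is applied as a selection at the lowest base relation or join where both of its attributes are available. A final projection on the attributes of $\mathrm{head}(q)$ is added. **Theorem.** There is a function $g$ with $g(q,\mathcal I)\le 2^{O(k\log k)}$, independent of the database and of the plan, such that for every CQ $q$, every finite set $\mathcal I$ of inequalities between variables of $q$ and every SPJ plan $\mathcal P_q$ for $q$, the plan $\mathcal P_{q,\mathcal I}$ computes $(q,\mathcal I)$; and if $\mathcal P_q$ runs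 in time at most $T(|q|,|D|)$ on every database $D$, then $\mathcal P_{q,\mathcal I}$ runs in time at most $g(q,\mathcal I)\cdot\max(T(|q|,|D|),|D|)$ on every database $D$. -/

import Mathlib

universe u v w x

open Filter Asymptotics

/-! ### Databases and conjunctive queries -/

/-- A database instance over the relation names `Rel` (with arities `ar`) and the domain `V`: every
relation is stored as a duplicate-free list of tuples, in an arbitrary order. -/
structure Database (Rel : Type u) (ar : Rel → ℕ) (V : Type v) where
  rel : (r : Rel) → List (Fin (ar r) → V)
  nodup : ∀ r, (rel r).Nodup

/-- `|D|`, the number of tuples of the database. -/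
def Database.size {Rel : Type u} [Fintype Rel] {ar : Rel → ℕ} {V : Type v}
    (D : Database Rel ar V) : ℕ :=
  ∑ r, (D.rel r).length

/-- A relational atom `R(t₁, …, tₙ)`; each term is a variable (`Sum.inl`) or a constant
(`Sum.inr`). -/
structure QAtom (Rel : Type u) (ar : Rel → ℕ) (V : Type v) (Var : Type w) where
  rel : Rel
  args : Fin (ar rel) → Var ⊕ V

/-- A conjunctive query: a list of atoms (the body) and a finite set of variables of the body
(the head). -/
structure CQ (Rel : Type u) (ar : Rel → ℕ) (V : Type v) (Var : Type w) where
  body : List (QAtom Rel ar V Var)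
  head : Finset Var
  safe : ∀ y ∈ head, ∃ a ∈ body, ∃ i, a.args i = Sum.inl y

namespace CQ

variable {Rel : Type u} {ar : Rel → ℕ} {V : Type v} {Var : Type w}

/-- The variables that occur in the body. -/
def vars (q : CQ Rel ar V Var) : Set Var :=
  {y | ∃ a ∈ q.body, ∃ i, a.args i = Sum.inl y}

/-- `|q|`, the number of symbols of the query. -/
def size (q : CQ Rel ar V Var) : ℕ :=
  1 + q.head.card + (q.body.map fun a => 1 + ar a.rel).sum

/-- The value of a term under a partial assignment of the variables. -/
def termValue (s : Var → Option V) : Var ⊕ V → Option V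
  | Sum.inl y => s y
  | Sum.inr c => some c

/-- The result of the full query (all variables of the body in the head): the assignments of values
to exactly the variables of `q` that map every atom to a tuple of the database. -/
def fullAnswers (q : CQ Rel ar V Var) (D : Database Rel ar V) : Set (Var → Option V) :=
  {s | (∀ y, s y ≠ none ↔ y ∈ q.vars) ∧
    ∀ a ∈ q.body, ∃ t ∈ D.rel a.rel, ∀ i, termValue s (a.args i) = some (t i)}

open scoped Classical in
/-- The result of `(q, I)`, where a pair `(y, z)` in `I` stands for the inequality `y ≠ z`: the
restrictions to the head of the full answers that satisfy all inequalities. -/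
def answers (q : CQ Rel ar V Var) (I : Finset (Var × Var)) (D : Database Rel ar V) :
    Set (Var → Option V) :=
  {h | ∃ s ∈ q.fullAnswers D, (∀ p ∈ I, s p.1 ≠ s p.2) ∧
    h = fun y => if y ∈ q.head then s y else none}

end CQ

open scoped Classical in
/-- The number `k` of variables that appear in a set of inequalities. -/
noncomputable def numIneqVars {Var : Type w} (I : Finset (Var × Var)) : ℕ :=
  (I.image Prod.fst ∪ I.image Prod.snd).card

/-! ### Query plans -/

/-- Atomic selection conditions on attributes: `a = b`, `a = c` with a constant `c`, `a ≠ b`. -/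
inductive Cond (V : Type v) (A : Type x) : Type (max v x)
  | eq (a b : A) : Cond V A
  | eqConst (a : A) (c : V) : Cond V A
  | ne (a b : A) : Cond V A

/-- Query plans with attributes from `A`. A leaf is a base relation together with the names of its
attributes; `join on P Q` is the equijoin on the listed pairs of attributes (the cartesian
product if the list is empty); `hproject X E P` is the `H`-projection on `X`, where `E` is the edge
set of the bipartite graph `H`. -/
inductive Plan (Rel : Type u) (ar : Rel → ℕ) (V : Type v) (A : Type x) : Type (max u v x)
  | base (r : Rel) (att : Fin (ar r) → A) : Plan Rel ar V A
  | select (θ : Cond V A) (P : Plan Rel ar V A) : Plan Rel ar V A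
  | project (X : Finset A) (P : Plan Rel ar V A) : Plan Rel ar V A
  | hproject (X : Finset A) (E : Finset (A × A)) (P : Plan Rel ar V A) : Plan Rel ar V A
  | join (on : List (A × A)) (P Q : Plan Rel ar V A) : Plan Rel ar V A

/-- Tuples over named attributes; `none` is the value at an attribute that the tuple does not
have. -/
abbrev Tup (V : Type v) (A : Type x) := A → Option V

section Operators

variable {V : Type v} {A : Type x}

/-- The truth of an atomic condition at a tuple. -/
def Cond.Holds (t : Tup V A) : Cond V A → Prop
  | .eq a b => t a = t b
  | .eqConst a c => t a = some c
  | .ne a b => t a ≠ t b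

open scoped Classical in
/-- The restriction of a tuple to the attributes in `X`. -/
noncomputable def Tup.restrict (X : Finset A) (t : Tup V A) : Tup V A :=
  fun a => if a ∈ X then t a else none

/-- The concatenation of two tuples over disjoint sets of attributes. -/
def Tup.concat (t s : Tup V A) : Tup V A :=
  fun a => (t a).orElse fun _ => s a

/-! Every operator below is an explicit algorithm that returns its output together with the number
of steps it made. One step is: reading a tuple, writing a tuple, one access to a dictionary, one
comparison of two values, or the creation of one node of a tree. -/

open scoped Classical in
/-- Selection by a scan. -/
noncomputable def runSelect (θ : Cond V A) : List (Tup V A) → List (Tup V A) × ℕ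
  | [] => ([], 0)
  | t :: ts =>
    if θ.Holds t then
      -- read, compare, write
      (t :: (runSelect θ ts).1, (runSelect θ ts).2 + 3)
    else
      -- read, compare
      ((runSelect θ ts).1, (runSelect θ ts).2 + 2)

open scoped Classical in
/-- Duplicate-free projection with a dictionary `seen` of the tuples written so far. -/
noncomputable def runProject (X : Finset A) :
    Set (Tup V A) → List (Tup V A) → List (Tup V A) × ℕ
  | _, [] => ([], 0)
  | seen, t :: ts =>
    if t.restrict X ∈ seen then
      -- read, look up
      ((runProject X seen ts).1, (runProject X seen ts).2 + 2)
    else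
      -- read, look up, insert, write
      (t.restrict X :: (runProject X (insert (t.restrict X) seen) ts).1,
        (runProject X (insert (t.restrict X) seen) ts).2 + 4)

open scoped Classical in
/-- First phase of the join: the tuples of the second input are entered into a dictionary, indexed
by their values at the join attributes. -/
noncomputable def buildIndex (on : List (A × A)) :
    (List (Option V) → List (Tup V A)) → List (Tup V A) →
      (List (Option V) → List (Tup V A)) × ℕ
  | idx, [] => (idx, 0)
  | idx, s :: ss =>
    -- read, insert
    let key := on.map fun e => s e.2
    let r := buildIndex on (Function.update idx key (s :: idx key)) ss
    (r.1, r.2 + 2)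

/-- Second phase of the join: every tuple of the first input is looked up in the dictionary, and
its concatenations with the tuples found there are written. -/
def probeIndex (on : List (A × A)) (idx : List (Option V) → List (Tup V A)) :
    List (Tup V A) → List (Tup V A) × ℕ
  | [] => ([], 0)
  | t :: ts =>
    -- read, look up, write every match
    let found := (idx (on.map fun e => t e.1)).map fun s => t.concat s
    let r := probeIndex on idx ts
    (found ++ r.1, r.2 + 2 + found.length)

/-- Equijoin with a dictionary. -/
noncomputable def runJoin (on : List (A × A)) (R S : List (Tup V A)) : List (Tup V A) × ℕ :=
  let b := buildIndex on (fun _ => []) S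
  let p := probeIndex on b.1 R
  (p.1, b.2 + p.2)

/-! #### The `H`-projection

The `H`-projection on `X` groups its input by the values at `X` and keeps, from each group, the
`H`-equivalent subset formed by the labels of the tree of forbidden tuples of the group. The tree
grows while the tuples are scanned. Only its leaves labelled `⊥*` are ever inspected again, so a
tree is stored as the list of these leaves; a leaf `v` is stored as the forbidden tuple that it
encodes, with `none` for `⊥`. The tree with only a root is the list `[fun _ => none]`. -/

/-- Case 1 for a tuple `t` and a leaf `v` labelled `⊥*`: for some edge `(a, b)` of `H` the leaf has
a value at `b`, and it is the value of `t` at `a`. -/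
def LeafHit (E : Finset (A × A)) (t v : Tup V A) : Prop :=
  ∃ e ∈ E, v e.2 ≠ none ∧ t e.1 = v e.2

open scoped Classical in
/-- The children that a leaf `v` gets in case 2, when it is labelled with the tuple `t`: one for
each edge `(a, b)` of `H` such that `b` has no value yet. -/
noncomputable def leafChildren (E : Finset (A × A)) (t v : Tup V A) : List (Tup V A) :=
  (E.toList.filter fun e => decide (v e.2 = none)).map fun e => Function.update v e.2 (t e.1)

open scoped Classical in
/-- The leaves labelled `⊥*` of one tree are processed with the tuple `t`. Returned are the new list
of such leaves, whether `t` became the label of a node, and the number of steps. -/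
noncomputable def processLeaves (E : Finset (A × A)) (t : Tup V A) :
    List (Tup V A) → List (Tup V A) × Bool × ℕ
  | [] => ([], false, 0)
  | v :: vs =>
    let r := processLeaves E t vs
    if LeafHit E t v then
      -- visit the leaf, go through the edges for the comparisons
      (v :: r.1, r.2.1, r.2.2 + 1 + E.card)
    else
      -- in addition write the label, go through the edges to create the children
      (leafChildren E t v ++ r.1, true, r.2.2 + 2 + 2 * E.card)

open scoped Classical in
/-- The `H`-projection, with a dictionary `trees` from the values at `X` to the tree of the
group. -/
noncomputable def runHProject (X : Finset A) (E : Finset (A × A)) :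
    (Tup V A → List (Tup V A)) → List (Tup V A) → List (Tup V A) × ℕ
  | _, [] => ([], 0)
  | trees, t :: ts =>
    let s := processLeaves E t (trees (t.restrict X))
    let r := runHProject X E (Function.update trees (t.restrict X) s.1) ts
    if s.2.1 = true then
      -- read, look up the tree, process it, store it, write
      (t :: r.1, r.2 + s.2.2 + 4)
    else
      (r.1, r.2 + s.2.2 + 3)

end Operators

namespace Plan

variable {Rel : Type u} {ar : Rel → ℕ} {V : Type v} {Var : Type w} {A : Type x}

/-- The evaluation of a plan, operator by operator: the output and the number of steps. Every
operator has one step of overhead; a stored base relation is only read by the operator above it. -/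
noncomputable def run (D : Database Rel ar V) : Plan Rel ar V A → List (Tup V A) × ℕ
  | base r att =>
    ((D.rel r).map fun t => Function.extend att (fun i => some (t i)) fun _ => none, 1)
  | select θ P =>
    let s := runSelect θ (run D P).1
    (s.1, (run D P).2 + s.2 + 1)
  | project X P =>
    let s := runProject X ∅ (run D P).1
    (s.1, (run D P).2 + s.2 + 1)
  | hproject X E P =>
    let s := runHProject X E (fun _ => [fun _ => none]) (run D P).1
    (s.1, (run D P).2 + s.2 + 1)
  | join on P Q =>
    let s := runJoin on (run D P).1 (run D Q).1
    (s.1, (run D P).2 + (run D Q).2 + s.2 + 1)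

/-- The output of the plan. -/
noncomputable def eval (P : Plan Rel ar V A) (D : Database Rel ar V) : List (Tup V A) :=
  (P.run D).1

/-- The running time of the plan. -/
noncomputable def time (P : Plan Rel ar V A) (D : Database Rel ar V) : ℕ :=
  (P.run D).2

open scoped Classical in
/-- The attributes of all the base relations of the plan. -/
noncomputable def leafAtts : Plan Rel ar V A → Finset A
  | base _ att => Finset.univ.image att
  | select _ P => leafAtts P
  | project _ P => leafAtts P
  | hproject _ _ P => leafAtts P
  | join _ P Q => leafAtts P ∪ leafAtts Q

open scoped Classical in
/-- The attributes of the output of the plan. The tuples kept by an `H`-projection are not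
truncated. -/
noncomputable def atts : Plan Rel ar V A → Finset A
  | base _ att => Finset.univ.image att
  | select _ P => atts P
  | project X _ => X
  | hproject _ _ P => atts P
  | join _ P Q => atts P ∪ atts Q

/-- Well-formed plans: the attributes of the base relations are pairwise distinct, an operator only
refers to attributes of its input, and the graph of an `H`-projection has its edges between
attributes that are projected out and attributes that its input does not have. -/
def WellFormed : Plan Rel ar V A → Prop
  | base _ att => Function.Injective att
  | select (.eq a b) P => P.WellFormed ∧ a ∈ P.atts ∧ b ∈ P.atts
  | select (.eqConst a _) P => P.WellFormed ∧ a ∈ P.atts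
  | select (.ne a b) P => P.WellFormed ∧ a ∈ P.atts ∧ b ∈ P.atts
  | project X P => P.WellFormed ∧ X ⊆ P.atts
  | hproject X E P => P.WellFormed ∧ X ⊆ P.atts ∧
      ∀ e ∈ E, (e.1 ∈ P.atts ∧ e.1 ∉ X) ∧ e.2 ∉ P.atts
  | join on P Q => P.WellFormed ∧ Q.WellFormed ∧ Disjoint P.leafAtts Q.leafAtts ∧
      ∀ e ∈ on, e.1 ∈ P.atts ∧ e.2 ∈ Q.atts

/-- Select-Project-Join plans: only (equality) selections, projections and joins. -/
def IsSPJ : Plan Rel ar V A → Prop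
  | base _ _ => True
  | select (.eq _ _) P => P.IsSPJ
  | select (.eqConst _ _) P => P.IsSPJ
  | select (.ne _ _) _ => False
  | project _ P => P.IsSPJ
  | hproject _ _ _ => False
  | join _ P Q => P.IsSPJ ∧ Q.IsSPJ

/-- The part of a plan that is below the projections when these are all pulled to the top: since
attributes are pairwise distinct, the projections are simply left out. -/
def dropProj : Plan Rel ar V A → Plan Rel ar V A
  | base r att => base r att
  | select θ P => select θ P.dropProj
  | project _ P => P.dropProj
  | hproject _ _ P => P.dropProj
  | join on P Q => join on P.dropProj Q.dropProj

open scoped Classical in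
/-- The assignment of the variables in `S` that is read off a tuple, if the variable `y` is stored
at the attribute `ρ y`. -/
noncomputable def readVars (ρ : Var → A) (S : Set Var) (t : Tup V A) : Var → Option V :=
  fun y => if y ∈ S then t (ρ y) else none

open scoped Classical in
/-- On every database the plan outputs the answers of `(q, I)`, over the attributes of the head
variables. -/
def Computes (P : Plan Rel ar V A) (ρ : Var → A) (q : CQ Rel ar V Var)
    (I : Finset (Var × Var)) : Prop :=
  P.atts = q.head.image ρ ∧
    ∀ D : Database Rel ar V, {h | ∃ t ∈ P.eval D, h = readVars ρ q.head t} = q.answers I D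

/-- `P` is an SPJ plan for the query `q`, with the variable `y` stored at the attribute `ρ y`: it
computes `q`, and the projection-free plan that remains when all projections are pulled to the top
computes the full query. -/
structure IsSPJPlanFor (P : Plan Rel ar V A) (ρ : Var → A) (q : CQ Rel ar V Var) : Prop where
  spj : P.IsSPJ
  wellFormed : P.WellFormed
  computes : P.Computes ρ q ∅
  mem_leafAtts : ∀ y ∈ q.vars, ρ y ∈ P.leafAtts
  full : ∀ D : Database Rel ar V,
    {s | ∃ t ∈ P.dropProj.eval D, s = readVars ρ q.vars t} = q.fullAnswers D

/-! ### The transformed plan -/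

/-- Selections for all the inequalities `a ≠ b` with `(a, b)` in `J`. -/
noncomputable def selectNe (J : Finset (A × A)) (P : Plan Rel ar V A) : Plan Rel ar V A :=
  J.toList.foldr (fun e Q => select (.ne e.1 e.2) Q) P

open scoped Classical in
/-- The plan that results from `σ_J (P₀)`, with `P₀` the projection-free part of the plan, when the
projections are pushed down again as `H`-projections: a projection becomes the `H`-projection for
the graph `H` of the inequalities between the attributes of its subplan that are projected out and
the attributes outside the subplan; an inequality is selected as soon as both its attributes
are there. -/
noncomputable def pushIneqs (J : Finset (A × A)) : Plan Rel ar V A → Plan Rel ar V A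
  | base r att =>
    selectNe (J.filter fun e => e.1 ∈ Finset.univ.image att ∧ e.2 ∈ Finset.univ.image att)
      (base r att)
  | select θ P => select θ (pushIneqs J P)
  | project X P =>
    hproject X
      ((J ∪ J.image Prod.swap).filter fun e =>
        (e.1 ∈ P.leafAtts ∧ e.1 ∉ X) ∧ e.2 ∉ P.leafAtts)
      (pushIneqs J P)
  | hproject X E P => hproject X E (pushIneqs J P)
  | join on P Q =>
    selectNe
      (J.filter fun e =>
        (e.1 ∈ P.leafAtts ∧ e.2 ∈ Q.leafAtts) ∨ (e.1 ∈ Q.leafAtts ∧ e.2 ∈ P.leafAtts))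
      (join on (pushIneqs J P) (pushIneqs J Q))

open scoped Classical in
/-- The transformed plan for `(q, I)`. The last projection drops the attributes that the
`H`-projections keep as witnesses. -/
noncomputable def transform (P : Plan Rel ar V A) (ρ : Var → A) (q : CQ Rel ar V Var)
    (I : Finset (Var × Var)) : Plan Rel ar V A :=
  project (q.head.image ρ) (P.pushIneqs (I.image fun p => (ρ p.1, ρ p.2)))

end Plan

/-! An `H`-projection keeps enough of each group: whenever some tuple of the group is compatible
with values `v` outside the subplan, so is a kept tuple (`exists_mem_runHProject`). Indeed, as long
as no tuple compatible with `v` has been scanned, the tree has a leaf all of whose values agree with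
`v`, and the first compatible tuple must label it.

Correctness follows by induction on the plan. Since kept tuples are not truncated, every output
tuple comes from the projection-free plan, and the selections enforce the inequalities
(`mem_dropProj_of_mem_eval_pushIneqs`). Conversely, each admissible tuple of the projection-free
plan has a representative that agrees with it on the attributes of the original plan
(`exists_mem_eval_pushIneqs`). That induction needs arbitrary outside values `v`, because at a join
each side is outside the other.

For the running time, outputs are compared fibrewise: restricting a tuple of the transformed plan to
the original attributes gives a tuple of the original output (`restrict_mem_eval`), so it suffices
to bound the fibres. If a kept tuple is paired with a leaf that it labels, it does not hit its own
leaf but hits those of all later kept tuples. The polynomial method (`card_le_pow_of_skew_pairs`)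
then bounds a group by (r + 1)^l, with l left and r right vertices of `H`. The exponent counts
attributes inside the subplan. Hence the bounds multiply correctly at joins, where attribute sets
are disjoint, and start afresh at each projection instead of compounding
(`countP_eval_pushIneqs_le`).

A separate potential argument on the leaves bounds the work per scanned tuple. Each original
operator spends at least two steps per input tuple, and these pay for the corresponding transformed
operator (`time_pushIneqs_le`). -/

/-- A skew Bollobás-type inequality for set pairs in a product, by the polynomial method. -/
theorem card_le_pow_of_skew_pairs {α ι : Type*} [Fintype ι] (w : ℕ) {m : ℕ}
    (t : Fin m → ι → α) (B : Fin m → ι → Finset α) (hB : ∀ i x, (B i x).card ≤ w)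
    (hdiag : ∀ i x, t i x ∉ B i x) (hskew : ∀ i j, i < j → ∃ x, t i x ∈ B j x) :
    m ≤ (w + 1) ^ Fintype.card ι := by
  classical
  -- The elements of `α` become independent indeterminates over ℚ, so distinct values stay distinct
  -- in a field.
  obtain ⟨K, _, φ, hφ⟩ : ∃ (K : Type _) (_ : Field K) (φ : α → K), Function.Injective φ :=
    ⟨FractionRing (MvPolynomial α ℚ), inferInstance,
      fun a => algebraMap (MvPolynomial α ℚ) _ (MvPolynomial.X a),
      (IsFractionRing.injective (MvPolynomial α ℚ) _).comp (MvPolynomial.X_injective)⟩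
  let p : Fin m → ι → Polynomial K := fun j x =>
    ∏ a ∈ B j x, (Polynomial.X - Polynomial.C (φ a))
  have hdeg : ∀ j x, (p j x).natDegree < w + 1 := fun j x => by
    rw [Polynomial.natDegree_prod_of_monic _ _ fun a _ => Polynomial.monic_X_sub_C _]
    simpa using Nat.lt_succ_of_le (hB j x)
  have heval : ∀ j x a, (p j x).eval (φ a) = 0 ↔ a ∈ B j x := fun j x a => by
    simp only [p, Polynomial.eval_prod, Finset.prod_eq_zero_iff, Polynomial.eval_sub,
      Polynomial.eval_X, Polynomial.eval_C, sub_eq_zero]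
    exact ⟨fun ⟨b, hb, h⟩ => hφ h ▸ hb, fun h => ⟨a, h, rfl⟩⟩
  -- Column `j` holds the values of one product polynomial at the points given by the `t i`. The
  -- skew condition kills the entries above the diagonal. Expansion into monomials of degree at most
  -- `w` in each variable factors `M` through a space of dimension `(w + 1) ^ |ι|`.
  let M : Matrix (Fin m) (Fin m) K := .of fun i j => ∏ x, (p j x).eval (φ (t i x))
  let F : Matrix (Fin m) (ι → Fin (w + 1)) K := .of fun i d => ∏ x, φ (t i x) ^ (d x : ℕ)
  let G : Matrix (ι → Fin (w + 1)) (Fin m) K := .of fun d j => ∏ x, (p j x).coeff (d x)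
  have hM : M = F * G := by
    ext i j
    simp only [M, F, G, Matrix.mul_apply, Matrix.of_apply, ← Finset.prod_mul_distrib]
    rw [← Fintype.prod_sum (fun x (d : Fin (w + 1)) => φ (t i x) ^ (d : ℕ) * (p j x).coeff d)]
    refine Finset.prod_congr rfl fun x _ => ?_
    rw [Polynomial.eval_eq_sum_range' (hdeg j x), Finset.sum_range]
    exact Finset.sum_congr rfl fun d _ => mul_comm _ _
  have hdet : M.det ≠ 0 := by
    rw [Matrix.det_of_isLowerTriangular M fun i j hij => ?_]
    · refine Finset.prod_ne_zero_iff.2 fun i _ => Finset.prod_ne_zero_iff.2 fun x _ => ?_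
      rw [Ne, heval]
      exact hdiag i x
    · obtain ⟨x, hx⟩ := hskew i j hij
      exact Finset.prod_eq_zero (Finset.mem_univ x) ((heval j x _).2 hx)
  have hrank : M.rank = m := by
    rw [Matrix.rank_of_isUnit M ((Matrix.isUnit_iff_isUnit_det M).2 (isUnit_iff_ne_zero.2 hdet)),
      Fintype.card_fin]
  calc m = (F * G).rank := by rw [← hM, hrank]
    _ ≤ F.rank := Matrix.rank_mul_le_left F G
    _ ≤ Fintype.card (ι → Fin (w + 1)) := Matrix.rank_le_card_width F
    _ = (w + 1) ^ Fintype.card ι := by simp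

/-! ### Counting lists by fibres -/

/-- Pigeonhole, removing one fibre of `f` for each entry of `m`. Repetitions in `m` do no harm, so
outputs of plans need not be shown duplicate-free. -/
theorem List.length_le_mul_of_countP_le {α β : Type*} [DecidableEq β] (f : α → β) (c : ℕ)
    (m : List β) : ∀ l : List α, (∀ a ∈ l, f a ∈ m) →
      (∀ b, l.countP (fun a => decide (f a = b)) ≤ c) → l.length ≤ c * m.length := by
  induction m with
  | nil =>
    intro l hl _
    cases l with
    | nil => simp
    | cons a l => simpa using hl a (by simp)
  | cons b m ih =>
    intro l hl hc
    have h := ih (l.filter fun a => !decide (f a = b))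
      (fun a ha => by
        have h1 := List.mem_filter.1 ha
        have h2 := hl a h1.1
        simp_all)
      (fun b' => (List.Sublist.countP_le List.filter_sublist).trans (hc b'))
    have h1 := List.length_eq_countP_add_countP (l := l) (fun a => decide (f a = b))
    have h2 := hc b
    rw [← List.countP_eq_length_filter] at h
    simp only [decide_eq_true_eq, decide_not] at h1
    rw [List.length_cons, mul_add]
    omega

theorem List.countP_flatMap_le {α β : Type*} (l : List α) (f : α → List β) (p : β → Bool)
    (p' : α → Bool) (n : ℕ) (h : ∀ a ∈ l, (f a).countP p ≤ if p' a then n else 0) :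
    (l.flatMap f).countP p ≤ l.countP p' * n := by
  induction l with
  | nil => simp
  | cons a l ih =>
    have h1 := h a (by simp)
    have h2 := ih fun b hb => h b (by simp [hb])
    rw [List.flatMap_cons, List.countP_append, List.countP_cons, add_mul]
    split_ifs at h1 ⊢ <;> omega

/-! ### Tuples and the relational operators: outputs and step counts -/

section Operators

variable {V : Type v} {A : Type x}

open scoped Classical in
theorem Tup.restrict_apply_of_mem {X : Finset A} {a : A} (h : a ∈ X) (t : Tup V A) :
    t.restrict X a = t a := by simp [Tup.restrict, h]

theorem Tup.restrict_eq_restrict_iff {X : Finset A} {t s : Tup V A} :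
    t.restrict X = s.restrict X ↔ ∀ a ∈ X, t a = s a := by
  classical
  refine ⟨fun h a ha => ?_, fun h => ?_⟩
  · have := congrFun h a
    simpa [Tup.restrict, ha] using this
  · funext a
    by_cases ha : a ∈ X <;> simp [Tup.restrict, ha, h]

theorem Tup.restrict_restrict_of_subset {X Y : Finset A} (h : X ⊆ Y) (t : Tup V A) :
    (t.restrict Y).restrict X = t.restrict X :=
  Tup.restrict_eq_restrict_iff.2 fun _ ha => Tup.restrict_apply_of_mem (h ha) t

theorem Tup.concat_apply_of_ne_none {t s : Tup V A} {a : A} (h : t a ≠ none) :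
    t.concat s a = t a := by
  unfold Tup.concat
  cases h' : t a <;> simp_all

theorem Tup.concat_apply_of_eq_none {t s : Tup V A} {a : A} (h : t a = none) :
    t.concat s a = s a := by
  simp [Tup.concat, h]

/-! ### Selection -/

open scoped Classical in
theorem runSelect_fst (θ : Cond V A) (ts : List (Tup V A)) :
    (runSelect θ ts).1 = ts.filter fun t => decide (θ.Holds t) := by
  induction ts with
  | nil => simp [runSelect]
  | cons t ts ih => by_cases h : θ.Holds t <;> simp [runSelect, h, ih]

theorem runSelect_snd_le (θ : Cond V A) (ts : List (Tup V A)) :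
    (runSelect θ ts).2 ≤ 3 * ts.length := by
  induction ts with
  | nil => simp [runSelect]
  | cons t ts ih => by_cases h : θ.Holds t <;> simp [runSelect, h] <;> omega

/-- A lower bound on the cost of the original operator; these steps later pay for the transformed
one. -/
theorem two_mul_length_le_runSelect_snd (θ : Cond V A) (ts : List (Tup V A)) :
    2 * ts.length ≤ (runSelect θ ts).2 := by
  induction ts with
  | nil => simp [runSelect]
  | cons t ts ih => by_cases h : θ.Holds t <;> simp [runSelect, h] <;> omega

theorem length_runSelect_fst_le (θ : Cond V A) (ts : List (Tup V A)) :
    (runSelect θ ts).1.length ≤ (runSelect θ ts).2 := by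
  have h := two_mul_length_le_runSelect_snd θ ts
  have h' : (runSelect θ ts).1.length ≤ ts.length := by
    rw [runSelect_fst]
    exact List.length_filter_le _ _
  omega

/-! ### Projection -/

theorem mem_runProject (X : Finset A) (u : Tup V A) (ts : List (Tup V A)) :
    ∀ seen, u ∈ (runProject X seen ts).1 ↔ u ∉ seen ∧ ∃ t ∈ ts, t.restrict X = u := by
  induction ts with
  | nil => simp [runProject]
  | cons t ts ih =>
    intro seen
    by_cases h : t.restrict X ∈ seen
    · simp only [runProject, h, if_true, ih, List.mem_cons, exists_eq_or_imp]
      refine and_congr_right fun hu => ⟨Or.inr, ?_⟩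
      rintro (rfl | h')
      · exact absurd h hu
      · exact h'
    · simp only [runProject, h, if_false, ih, List.mem_cons, exists_eq_or_imp,
        Set.mem_insert_iff, not_or]
      constructor
      · rintro (rfl | h')
        · exact ⟨h, Or.inl rfl⟩
        · exact ⟨h'.1.2, Or.inr h'.2⟩
      · rintro ⟨hu, h'⟩
        by_cases hut : u = t.restrict X
        · exact Or.inl hut
        · exact Or.inr ⟨⟨hut, hu⟩, h'.resolve_left fun h'' => hut h''.symm⟩

theorem runProject_bounds (X : Finset A) (ts : List (Tup V A)) :
    ∀ seen, (runProject X seen ts).2 ≤ 4 * ts.length ∧ 2 * ts.length ≤ (runProject X seen ts).2 ∧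
      (runProject X seen ts).1.length ≤ (runProject X seen ts).2 := by
  induction ts with
  | nil => simp [runProject]
  | cons t ts ih =>
    intro seen
    by_cases h : t.restrict X ∈ seen
    · have := ih seen
      simp only [runProject, h, if_true, List.length_cons]
      omega
    · have := ih (insert (t.restrict X) seen)
      simp only [runProject, h, if_false, List.length_cons]
      omega

/-! ### Join -/

open scoped Classical in
theorem buildIndex_fst (on : List (A × A)) (ss : List (Tup V A)) :
    ∀ idx key, (buildIndex on idx ss).1 key =
      (ss.filter fun s => decide ((on.map fun e => s e.2) = key)).reverse ++ idx key := by
  induction ss with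
  | nil => simp [buildIndex]
  | cons s ss ih =>
    intro idx key
    simp only [buildIndex, ih, List.filter_cons]
    by_cases h : (on.map fun e => s e.2) = key
    · subst h
      simp
    · simp [h, Function.update_of_ne (Ne.symm h)]

theorem buildIndex_snd (on : List (A × A)) (ss : List (Tup V A)) :
    ∀ idx, (buildIndex on idx ss).2 = 2 * ss.length := by
  induction ss with
  | nil => simp [buildIndex]
  | cons s ss ih =>
    intro idx
    simp only [buildIndex, ih, List.length_cons]
    omega

theorem probeIndex_fst (on : List (A × A)) (idx : List (Option V) → List (Tup V A))
    (ts : List (Tup V A)) :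
    (probeIndex on idx ts).1 =
      ts.flatMap fun t => (idx (on.map fun e => t e.1)).map fun s => t.concat s := by
  induction ts with
  | nil => simp [probeIndex]
  | cons t ts ih => simp only [probeIndex, ih, List.flatMap_cons]

theorem probeIndex_snd (on : List (A × A)) (idx : List (Option V) → List (Tup V A))
    (ts : List (Tup V A)) :
    (probeIndex on idx ts).2 = 2 * ts.length + (probeIndex on idx ts).1.length := by
  induction ts with
  | nil => simp [probeIndex]
  | cons t ts ih =>
    simp only [probeIndex, ih, List.length_cons, List.length_append]
    omega

open scoped Classical in
theorem runJoin_fst (on : List (A × A)) (R S : List (Tup V A)) :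
    (runJoin on R S).1 = R.flatMap fun t =>
      ((S.filter fun s => decide ((on.map fun e => s e.2) = on.map fun e => t e.1)).reverse).map
        fun s => t.concat s := by
  simp only [runJoin, probeIndex_fst, buildIndex_fst, List.append_nil]

theorem runJoin_snd (on : List (A × A)) (R S : List (Tup V A)) :
    (runJoin on R S).2 = 2 * R.length + 2 * S.length + (runJoin on R S).1.length := by
  simp only [runJoin, probeIndex_snd, buildIndex_snd]
  omega

theorem mem_runJoin (on : List (A × A)) (R S : List (Tup V A)) (u : Tup V A) :
    u ∈ (runJoin on R S).1 ↔
      ∃ t ∈ R, ∃ s ∈ S, (∀ e ∈ on, t e.1 = s e.2) ∧ u = t.concat s := by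
  rw [runJoin_fst]
  simp only [List.mem_flatMap, List.mem_map, List.mem_reverse, List.mem_filter,
    decide_eq_true_eq, List.map_inj_left]
  constructor
  · rintro ⟨t, ht, s, ⟨hs, h⟩, rfl⟩
    exact ⟨t, ht, s, hs, fun e he => (h e he).symm, rfl⟩
  · rintro ⟨t, ht, s, hs, h, rfl⟩
    exact ⟨t, ht, s, ⟨hs, fun e he => (h e he).symm⟩, rfl⟩

/-- A tuple of the left input contributes only if it satisfies `pR`, and then at most one output per
right tuple satisfying `pS`. This makes fibre bounds multiply at a join. -/
theorem countP_runJoin_le (on : List (A × A)) (R S : List (Tup V A)) (p pR pS : Tup V A → Bool)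
    (h : ∀ t ∈ R, ∀ s ∈ S, p (t.concat s) = true → pR t = true ∧ pS s = true) :
    (runJoin on R S).1.countP p ≤ R.countP pR * S.countP pS := by
  classical
  rw [runJoin_fst]
  refine List.countP_flatMap_le _ _ _ _ _ fun t ht => ?_
  rw [List.countP_map, List.countP_reverse]
  split_ifs with hp
  · refine (List.Sublist.countP_le List.filter_sublist).trans
      (List.countP_mono_left fun s hs hs' => (h t ht s hs hs').2)
  · rw [Nat.le_zero, List.countP_eq_zero]
    exact fun s hs hs' => hp (h t ht s (List.mem_filter.1 hs).1 hs').1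

end Operators

/-! ### The `H`-projection and its trees of forbidden tuples -/

section HProjection

variable {V : Type v} {A : Type x}

/-- The leaf `v` is an ancestor of `u`: `u` has all the values of `v`. -/
def LeafLE (v u : Tup V A) : Prop := ∀ a, v a ≠ none → v a = u a

theorem LeafLE.trans {a b c : Tup V A} (h : LeafLE a b) (h' : LeafLE b c) : LeafLE a c :=
  fun x hx => by
    have h1 := h x hx
    rw [h1]
    exact h' x (h1 ▸ hx)

theorem LeafHit.mono {E : Finset (A × A)} {t v u : Tup V A} (h : LeafHit E t v)
    (hvu : LeafLE v u) : LeafHit E t u := by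
  obtain ⟨e, he, h1, h2⟩ := h
  have h3 := hvu e.2 h1
  exact ⟨e, he, h3 ▸ h1, h2.trans h3⟩

theorem leafLE_update [DecidableEq A] {v : Tup V A} {a : A} (h : v a = none) (c : Option V) :
    LeafLE v (Function.update v a c) := by
  intro x hx
  rw [Function.update_of_ne]
  rintro rfl
  exact hx h

open scoped Classical in
theorem mem_processLeaves {E : Finset (A × A)} {t u : Tup V A} {vs : List (Tup V A)} :
    u ∈ (processLeaves E t vs).1 ↔ ∃ v ∈ vs, (LeafHit E t v ∧ u = v) ∨
      (¬ LeafHit E t v ∧ ∃ e ∈ E, v e.2 = none ∧ u = Function.update v e.2 (t e.1)) := by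
  induction vs with
  | nil => simp [processLeaves]
  | cons v vs ih =>
    simp only [List.mem_cons, exists_eq_or_imp, ← ih]
    by_cases h : LeafHit E t v
    · simp [processLeaves, h]
    · simp only [processLeaves, h, if_false, List.mem_append, leafChildren, List.mem_map,
        List.mem_filter, Finset.mem_toList, decide_eq_true_eq, false_and, not_false_eq_true,
        true_and, false_or]
      refine or_congr_left (exists_congr fun e => ?_)
      constructor
      · rintro ⟨⟨h1, h2⟩, rfl⟩
        exact ⟨h1, h2, rfl⟩
      · rintro ⟨h1, h2, rfl⟩
        exact ⟨⟨h1, h2⟩, rfl⟩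

theorem processLeaves_flag {E : Finset (A × A)} {t : Tup V A} {vs : List (Tup V A)} :
    (processLeaves E t vs).2.1 = true ↔ ∃ v ∈ vs, ¬ LeafHit E t v := by
  induction vs with
  | nil => simp [processLeaves]
  | cons v vs ih =>
    by_cases h : LeafHit E t v
    · simp [processLeaves, h, ih]
    · simp [processLeaves, h]

theorem processLeaves_time_le (E : Finset (A × A)) (t : Tup V A) (vs : List (Tup V A)) :
    (processLeaves E t vs).2.2 ≤ vs.length * (2 + 2 * E.card) := by
  induction vs with
  | nil => simp [processLeaves]
  | cons v vs ih =>
    by_cases h : LeafHit E t v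
    · simp only [processLeaves, h, if_true, List.length_cons, add_mul, one_mul]
      omega
    · simp only [processLeaves, h, if_false, List.length_cons, add_mul, one_mul]
      omega

open scoped Classical in
theorem exists_leafLE_of_mem_processLeaves {E : Finset (A × A)} {t u : Tup V A}
    {vs : List (Tup V A)} (hu : u ∈ (processLeaves E t vs).1) : ∃ v ∈ vs, LeafLE v u := by
  obtain ⟨v, hv, ⟨_, rfl⟩ | ⟨_, e, _, h, rfl⟩⟩ := mem_processLeaves.1 hu
  · exact ⟨u, hv, fun _ _ => rfl⟩
  · exact ⟨v, hv, leafLE_update h _⟩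

/-- A leaf that stays was hit already, and a new child carries a value copied from `t`. That value
must not be `none`, which encodes the absence of a value. -/
theorem leafHit_of_mem_processLeaves {E : Finset (A × A)} {t u : Tup V A}
    {vs : List (Tup V A)} (ht : ∀ e ∈ E, t e.1 ≠ none) (hu : u ∈ (processLeaves E t vs).1) :
    LeafHit E t u := by
  obtain ⟨v, hv, ⟨h, rfl⟩ | ⟨_, e, he, h, rfl⟩⟩ := mem_processLeaves.1 hu
  · exact h
  · exact ⟨e, he, by simpa using ht e he, by simp⟩

/-! #### Size of the trees -/

open scoped Classical in
/-- The number of attributes on the right side of the graph that have no value yet. -/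
noncomputable def leafRank (E : Finset (A × A)) (v : Tup V A) : ℕ :=
  ((E.image Prod.snd).filter fun a => v a = none).card

/-- A bound on the number of leaves below the given leaves. -/
noncomputable def leafWeight (E : Finset (A × A)) (vs : List (Tup V A)) : ℕ :=
  (vs.map fun v => (E.card + 1) ^ leafRank E v).sum

theorem length_le_leafWeight (E : Finset (A × A)) (vs : List (Tup V A)) :
    vs.length ≤ leafWeight E vs := by
  induction vs with
  | nil => simp
  | cons v vs ih =>
    have : 0 < (E.card + 1) ^ leafRank E v := by positivity
    simp only [leafWeight, List.map_cons, List.sum_cons, List.length_cons] at *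
    omega

open scoped Classical in
theorem leafRank_update {E : Finset (A × A)} {e : A × A} (he : e ∈ E)
    {v : Tup V A} (hv : v e.2 = none) {c : Option V} (hc : c ≠ none) :
    leafRank E (Function.update v e.2 c) < leafRank E v := by
  refine Finset.card_lt_card ⟨fun a ha => ?_, fun h => ?_⟩
  · simp only [Finset.mem_filter] at ha ⊢
    refine ⟨ha.1, ?_⟩
    by_cases hae : a = e.2
    · rw [hae, hv]
    · simpa [Function.update_of_ne hae] using ha.2
  · have h' := h (Finset.mem_filter.2 ⟨Finset.mem_image_of_mem _ he, hv⟩)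
    exact hc (by simpa using (Finset.mem_filter.1 h').2)

/-- Potential argument: at most `E.card` children replace the leaf, and each has a right attribute
fewer to fill. So the weight does not grow, and the weight of the root bounds the number of leaves
forever. -/
theorem leafWeight_leafChildren_le {E : Finset (A × A)} {t v : Tup V A}
    (ht : ∀ e ∈ E, t e.1 ≠ none) :
    leafWeight E (leafChildren E t v) ≤ (E.card + 1) ^ leafRank E v := by
  classical
  by_cases h0 : leafRank E v = 0
  · have : leafChildren E t v = [] := by
      rw [leafChildren, List.map_eq_nil_iff, List.filter_eq_nil_iff]
      intro e he hv
      have := leafRank_update (Finset.mem_toList.1 he) (of_decide_eq_true hv)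
        (ht e (Finset.mem_toList.1 he))
      omega
    simp [this, leafWeight]
  · obtain ⟨n, hn⟩ := Nat.exists_eq_succ_of_ne_zero h0
    have h1 : leafWeight E (leafChildren E t v) ≤
        (leafChildren E t v).length • (E.card + 1) ^ n := by
      refine (List.sum_le_card_nsmul _ _ ?_).trans_eq (by rw [List.length_map])
      intro x hx
      obtain ⟨u, hu, rfl⟩ := List.mem_map.1 hx
      obtain ⟨e, he, rfl⟩ := List.mem_map.1 hu
      rw [List.mem_filter, Finset.mem_toList, decide_eq_true_eq] at he
      have := leafRank_update he.1 he.2 (ht e he.1)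
      exact Nat.pow_le_pow_right (by omega) (by omega)
    have h2 : (leafChildren E t v).length ≤ E.card := by
      rw [leafChildren, List.length_map]
      exact (List.length_filter_le _ _).trans_eq (Finset.length_toList E)
    rw [smul_eq_mul] at h1
    rw [hn, pow_succ, mul_comm]
    exact h1.trans (Nat.mul_le_mul_right _ (by omega))

theorem leafWeight_processLeaves_le {E : Finset (A × A)} {t : Tup V A}
    (ht : ∀ e ∈ E, t e.1 ≠ none) (vs : List (Tup V A)) :
    leafWeight E (processLeaves E t vs).1 ≤ leafWeight E vs := by
  induction vs with
  | nil => simp [processLeaves]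
  | cons v vs ih =>
    by_cases h : LeafHit E t v
    · simp only [processLeaves, h, if_true, leafWeight, List.map_cons, List.sum_cons] at ih ⊢
      omega
    · have h1 := leafWeight_leafChildren_le (v := v) ht
      simp only [processLeaves, h, if_false, leafWeight, List.map_append, List.map_cons,
        List.sum_append, List.sum_cons] at ih h1 ⊢
      omega

theorem runHProject_time_le {X : Finset A} {E : Finset (A × A)} {L : ℕ} (ts : List (Tup V A)) :
    ∀ trees : Tup V A → List (Tup V A), (∀ t ∈ ts, ∀ e ∈ E, t e.1 ≠ none) →
      (∀ r, leafWeight E (trees r) ≤ L) →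
      (runHProject X E trees ts).2 ≤ ts.length * (L * (2 + 2 * E.card) + 4) := by
  classical
  induction ts with
  | nil => simp [runHProject]
  | cons t ts ih =>
    intro trees ht hL
    have h1 := ih (Function.update trees (t.restrict X)
        (processLeaves E t (trees (t.restrict X))).1) (fun s hs => ht s (by simp [hs])) (by
      intro r
      by_cases hr : r = t.restrict X
      · rw [hr, Function.update_self]
        exact (leafWeight_processLeaves_le (ht t (by simp)) _).trans (hL _)
      · rw [Function.update_of_ne hr]
        exact hL r)
    have h2 : (processLeaves E t (trees (t.restrict X))).2.2 ≤ L * (2 + 2 * E.card) :=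
      (processLeaves_time_le E t _).trans
        (Nat.mul_le_mul_right _ ((length_le_leafWeight E _).trans (hL _)))
    rw [List.length_cons, add_mul, one_mul]
    simp only [runHProject]
    split_ifs <;> simp only <;> omega

/-! #### Size of the output -/

theorem runHProject_sublist (X : Finset A) (E : Finset (A × A)) (ts : List (Tup V A)) :
    ∀ trees, ((runHProject X E trees ts).1).Sublist ts := by
  induction ts with
  | nil => simp [runHProject]
  | cons t ts ih =>
    intro trees
    simp only [runHProject]
    split_ifs
    · exact (ih _).cons_cons _
    · exact (ih _).cons _

-- Each kept tuple of the group is paired with a leaf that it labels. The last clause records an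
-- ancestor of that leaf in the current tree; it carries the induction, since the ancestors left
-- after processing `t` are all hit by `t` and hits are inherited by descendants.
open scoped Classical in
theorem exists_skew_leaves {X : Finset A} {E : Finset (A × A)} (r : Tup V A)
    (ts : List (Tup V A)) :
    ∀ trees : Tup V A → List (Tup V A), (∀ t ∈ ts, ∀ e ∈ E, t e.1 ≠ none) →
      ∃ L : List (Tup V A × Tup V A),
        L.map Prod.fst = (runHProject X E trees ts).1.filter (fun t => decide (t.restrict X = r)) ∧
        L.Pairwise (fun p p' => LeafHit E p.1 p'.2) ∧
        ∀ p ∈ L, ¬ LeafHit E p.1 p.2 ∧ ∃ v ∈ trees r, LeafLE v p.2 := by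
  induction ts with
  | nil => intro trees _; exact ⟨[], by simp [runHProject]⟩
  | cons t ts ih =>
    intro trees ht
    obtain ⟨L, h1, h2, h3⟩ := ih (Function.update trees (t.restrict X)
        (processLeaves E t (trees (t.restrict X))).1) (fun s hs => ht s (by simp [hs]))
    by_cases hr : t.restrict X = r
    · subst hr
      rw [Function.update_self] at h3
      have h4 : ∀ p ∈ L, LeafHit E t p.2 ∧ ∃ v ∈ trees (t.restrict X), LeafLE v p.2 := by
        intro p hp
        obtain ⟨-, u, hu, hup⟩ := h3 p hp
        obtain ⟨v, hv, hvu⟩ := exists_leafLE_of_mem_processLeaves hu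
        exact ⟨(leafHit_of_mem_processLeaves (ht t (by simp)) hu).mono hup, v, hv, hvu.trans hup⟩
      by_cases hf : (processLeaves E t (trees (t.restrict X))).2.1 = true
      -- A tuple may label several leaves; any one of them serves as its partner.
      · obtain ⟨v, hv, hvt⟩ := processLeaves_flag.1 hf
        refine ⟨(t, v) :: L, ?_, ?_, ?_⟩
        · simp only [runHProject, hf, if_true, List.map_cons, List.filter_cons, decide_true, h1]
        · exact List.pairwise_cons.2 ⟨fun p hp => (h4 p hp).1, h2⟩
        · intro p hp
          rcases List.mem_cons.1 hp with rfl | hp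
          · exact ⟨hvt, v, hv, fun _ _ => rfl⟩
          · exact ⟨(h3 p hp).1, (h4 p hp).2⟩
      · refine ⟨L, ?_, h2, fun p hp => ⟨(h3 p hp).1, (h4 p hp).2⟩⟩
        simp only [runHProject, hf, h1]
        simp
    · rw [Function.update_of_ne (Ne.symm hr)] at h3
      refine ⟨L, ?_, h2, h3⟩
      by_cases hf : (processLeaves E t (trees (t.restrict X))).2.1 = true
      · simp only [runHProject, hf, if_true, List.filter_cons, hr, decide_false, h1]
        simp
      · simp only [runHProject, hf, h1]
        simp

-- Hitting a leaf `v` means that, for some left attribute `x`, the value of `t` at `x` lies in the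
-- set of values of `v` at the neighbours of `x`. These sets have at most as many elements as there
-- are right attributes, so the skew inequality applies.
open scoped Classical in
theorem length_le_of_skew_leaves {E : Finset (A × A)} (L : List (Tup V A × Tup V A))
    (h : L.Pairwise (fun p p' => LeafHit E p.1 p'.2)) (h' : ∀ p ∈ L, ¬ LeafHit E p.1 p.2) :
    L.length ≤ ((E.image Prod.snd).card + 1) ^ (E.image Prod.fst).card := by
  obtain ⟨B, hB, hcard⟩ : ∃ B : Tup V A → A → Finset (Option V),
      (∀ v x c, c ∈ B v x ↔ ∃ e ∈ E, e.1 = x ∧ v e.2 ≠ none ∧ c = v e.2) ∧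
      ∀ v x, (B v x).card ≤ (E.image Prod.snd).card := by
    refine ⟨fun v x => ((E.filter fun e => e.1 = x ∧ v e.2 ≠ none).image Prod.snd).image v,
      fun v x c => ?_, fun v x => Finset.card_image_le.trans
        (Finset.card_le_card (Finset.image_subset_image (Finset.filter_subset _ _)))⟩
    simp only [Finset.mem_image, Finset.mem_filter]
    constructor
    · rintro ⟨y, ⟨e, ⟨he, h1, h2⟩, rfl⟩, rfl⟩
      exact ⟨e, he, h1, h2, rfl⟩
    · rintro ⟨e, he, h1, h2, rfl⟩
      exact ⟨e.2, ⟨e, ⟨he, h1, h2⟩, rfl⟩, rfl⟩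
  have key : ∀ t v : Tup V A, LeafHit E t v ↔
      ∃ x : {x // x ∈ E.image Prod.fst}, t x ∈ B v x := by
    intro t v
    constructor
    · rintro ⟨e, he, h1, h2⟩
      exact ⟨⟨e.1, Finset.mem_image_of_mem _ he⟩, (hB _ _ _).2 ⟨e, he, rfl, h1, h2⟩⟩
    · rintro ⟨x, hx⟩
      obtain ⟨e, he, h1, h2, h3⟩ := (hB _ _ _).1 hx
      exact ⟨e, he, h2, by rw [h1, h3]⟩
  have := card_le_pow_of_skew_pairs (ι := {x // x ∈ E.image Prod.fst}) (E.image Prod.snd).card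
    (fun (i : Fin L.length) x => (L.get i).1 x) (fun i x => B (L.get i).2 x)
    (fun i x => hcard _ _)
    (fun i x hx => h' _ (L.get_mem i) ((key _ _).2 ⟨x, hx⟩))
    (fun i j hij => (key _ _).1 (List.pairwise_iff_get.1 h i j hij))
  rwa [Fintype.card_coe] at this

open scoped Classical in
theorem countP_runHProject_le {X : Finset A} {E : Finset (A × A)} (r : Tup V A)
    (trees : Tup V A → List (Tup V A)) {ts : List (Tup V A)}
    (ht : ∀ t ∈ ts, ∀ e ∈ E, t e.1 ≠ none) :
    (runHProject X E trees ts).1.countP (fun t => decide (t.restrict X = r)) ≤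
      ((E.image Prod.snd).card + 1) ^ (E.image Prod.fst).card := by
  obtain ⟨L, h1, h2, h3⟩ := exists_skew_leaves (X := X) r ts trees ht
  rw [List.countP_eq_length_filter, ← h1, List.length_map]
  exact length_le_of_skew_leaves L h2 fun p hp => (h3 p hp).1

/-! #### `H`-equivalence -/

/-- Invariant: the group's tree has a leaf below which `v` still fits. A compatible tuple cannot hit
this leaf and is therefore kept; an incompatible one leaves such a leaf behind. -/
theorem exists_mem_runHProject {X : Finset A} {E : Finset (A × A)} {v t₀ : Tup V A}
    (hv : ∀ e ∈ E, t₀ e.1 ≠ v e.2) (ts : List (Tup V A)) :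
    ∀ trees : Tup V A → List (Tup V A), t₀ ∈ ts → (∃ l ∈ trees (t₀.restrict X), LeafLE l v) →
      ∃ t ∈ (runHProject X E trees ts).1, t.restrict X = t₀.restrict X ∧
        ∀ e ∈ E, t e.1 ≠ v e.2 := by
  classical
  induction ts with
  | nil => simp
  | cons t ts ih =>
    rintro trees ht ⟨l, hl, hlv⟩
    have hhead : ∀ s ∈ (runHProject X E (Function.update trees (t.restrict X)
        (processLeaves E t (trees (t.restrict X))).1) ts).1,
        s ∈ (runHProject X E trees (t :: ts)).1 := by
      intro s hs
      simp only [runHProject]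
      split_ifs
      · exact List.mem_cons_of_mem _ hs
      · exact hs
    have hkeep : t.restrict X = t₀.restrict X → ¬ LeafHit E t l →
        t ∈ (runHProject X E trees (t :: ts)).1 := by
      intro hr hh
      have := processLeaves_flag.2 ⟨l, hr ▸ hl, hh⟩
      simp [runHProject, this]
    have hnh : ∀ s : Tup V A, (∀ e ∈ E, s e.1 ≠ v e.2) → ¬ LeafHit E s l := by
      rintro s hs ⟨e, he, h1, h2⟩
      exact hs e he (h2.trans (hlv _ h1))
    by_cases hr : t.restrict X = t₀.restrict X
    · by_cases hc : ∀ e ∈ E, t e.1 ≠ v e.2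
      · exact ⟨t, hkeep hr (hnh t hc), hr, hc⟩
      · have htt : t₀ ∈ ts := (List.mem_cons.1 ht).resolve_left fun h => hc (h ▸ hv)
        have : ∃ l' ∈ (processLeaves E t (trees (t.restrict X))).1, LeafLE l' v := by
          by_cases hh : LeafHit E t l
          · exact ⟨l, mem_processLeaves.2 ⟨l, hr ▸ hl, Or.inl ⟨hh, rfl⟩⟩, hlv⟩
          · push Not at hc
            obtain ⟨e, he, hev⟩ := hc
            by_cases hle : l e.2 = none
            · refine ⟨_, mem_processLeaves.2 ⟨l, hr ▸ hl, Or.inr ⟨hh, e, he, hle, rfl⟩⟩, ?_⟩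
              intro a ha
              by_cases hae : a = e.2
              · subst hae
                rw [Function.update_self, hev]
              · rw [Function.update_of_ne hae] at ha ⊢
                exact hlv a ha
            · exact absurd ⟨e, he, hle, hev.trans (hlv _ hle).symm⟩ hh
        obtain ⟨s, hs, hs'⟩ := ih (Function.update trees (t.restrict X)
          (processLeaves E t (trees (t.restrict X))).1) htt (by rwa [← hr, Function.update_self])
        exact ⟨s, hhead s hs, hs'⟩
    · have htt : t₀ ∈ ts := (List.mem_cons.1 ht).resolve_left fun h => hr (by rw [h])
      obtain ⟨s, hs, hs'⟩ := ih (Function.update trees (t.restrict X)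
        (processLeaves E t (trees (t.restrict X))).1) htt ⟨l, by rwa [Function.update_of_ne (Ne.symm hr)], hlv⟩
      exact ⟨s, hhead s hs, hs'⟩

end HProjection

/-! ### Supports of tuples and concatenation over disjoint attributes -/

section Support

variable {V : Type v} {A : Type x}

/-- The tuple has values exactly at the attributes in `L`. -/
def Tup.HasSupport (t : Tup V A) (L : Finset A) : Prop := ∀ a, t a ≠ none ↔ a ∈ L

theorem Tup.concat_apply_left {t s : Tup V A} {L : Finset A} (ht : t.HasSupport L) {a : A}
    (ha : a ∈ L) : t.concat s a = t a :=
  Tup.concat_apply_of_ne_none ((ht a).2 ha)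

theorem Tup.concat_apply_right {t s : Tup V A} {L L' : Finset A} (ht : t.HasSupport L)
    (h : Disjoint L L') {a : A} (ha : a ∈ L') : t.concat s a = s a := by
  refine Tup.concat_apply_of_eq_none ?_
  by_contra hn
  exact Finset.disjoint_left.1 h ((ht a).1 hn) ha

open scoped Classical in
theorem Tup.HasSupport.concat {t s : Tup V A} {L L' : Finset A} (ht : t.HasSupport L)
    (hs : s.HasSupport L') : (t.concat s).HasSupport (L ∪ L') := by
  intro a
  rw [Finset.mem_union]
  by_cases h : t a = none
  · rw [Tup.concat_apply_of_eq_none h, hs a]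
    exact ⟨Or.inr, fun h' => h'.resolve_left fun h'' => (ht a).2 h'' h⟩
  · rw [Tup.concat_apply_of_ne_none h]
    exact ⟨fun _ => Or.inl ((ht a).1 h), fun _ => h⟩

open scoped Classical in
theorem Tup.restrict_eq_self {t : Tup V A} {L : Finset A} (ht : t.HasSupport L) :
    t.restrict L = t := by
  funext a
  by_cases h : a ∈ L
  · simp [Tup.restrict, h]
  · have : t a = none := by
      by_contra hn
      exact h ((ht a).1 hn)
    simp [Tup.restrict, h, this]

open scoped Classical in
theorem Tup.restrict_concat {t s : Tup V A} {L L' X X' : Finset A} (ht : t.HasSupport L)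
    (h : Disjoint L L') (hX : X ⊆ L) (hX' : X' ⊆ L') :
    (t.concat s).restrict (X ∪ X') = (t.restrict X).concat (s.restrict X') := by
  funext a
  by_cases ha : a ∈ X
  · have h1 := Tup.concat_apply_left (s := s) ht (hX ha)
    have h2 : t.restrict X a = t a := Tup.restrict_apply_of_mem ha t
    rw [Tup.restrict_apply_of_mem (Finset.mem_union_left _ ha), h1,
      Tup.concat_apply_of_ne_none, h2]
    rw [h2]
    exact (ht a).2 (hX ha)
  · have h2 : t.restrict X a = none := by simp [Tup.restrict, ha]
    rw [Tup.concat_apply_of_eq_none h2]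
    by_cases ha' : a ∈ X'
    · rw [Tup.restrict_apply_of_mem (Finset.mem_union_right _ ha'),
        Tup.concat_apply_right ht h (hX' ha'), Tup.restrict_apply_of_mem ha']
    · simp [Tup.restrict, ha, ha']

end Support

namespace Plan

variable {Rel : Type u} {ar : Rel → ℕ} {V : Type v} {Var : Type w} {A : Type x}

/-! ### Attributes and well-formedness -/

theorem isSPJ_of_select {θ : Cond V A} {P : Plan Rel ar V A} (h : (select θ P).IsSPJ) :
    P.IsSPJ := by
  cases θ
  · exact h
  · exact h
  · exact h.elim

theorem wellFormed_of_select {θ : Cond V A} {P : Plan Rel ar V A} (h : (select θ P).WellFormed) :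
    P.WellFormed := by
  cases θ <;> exact h.1

theorem wellFormed_select_of_subset {θ : Cond V A} {P Q : Plan Rel ar V A}
    (h : (select θ P).WellFormed) (hQ : Q.WellFormed) (hPQ : P.atts ⊆ Q.atts) :
    (select θ Q).WellFormed := by
  cases θ
  · exact ⟨hQ, hPQ h.2.1, hPQ h.2.2⟩
  · exact ⟨hQ, hPQ h.2⟩
  · exact ⟨hQ, hPQ h.2.1, hPQ h.2.2⟩

/-- Transfers selections between a tuple and a representative that agrees with it only on the
attributes of the original subplan. -/
theorem holds_congr_of_wellFormed {θ : Cond V A} {P : Plan Rel ar V A}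
    (h : (select θ P).WellFormed) {t s : Tup V A} (hts : ∀ a ∈ P.atts, t a = s a) :
    θ.Holds t ↔ θ.Holds s := by
  cases θ
  · simp only [Cond.Holds, hts _ h.2.1, hts _ h.2.2]
  · simp only [Cond.Holds, hts _ h.2]
  · simp only [Cond.Holds, hts _ h.2.1, hts _ h.2.2]

theorem atts_subset_leafAtts {P : Plan Rel ar V A} (h : P.WellFormed) : P.atts ⊆ P.leafAtts := by
  classical
  induction P with
  | base r att => exact subset_rfl
  | select θ P ih => exact ih (wellFormed_of_select h)
  | project X P ih => exact h.2.trans (ih h.1)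
  | hproject X E P ih => exact ih h.1
  | join on P Q ihP ihQ => exact Finset.union_subset_union (ihP h.1) (ihQ h.2.1)

theorem selectNe_induction {p : Plan Rel ar V A → Prop} (J : Finset (A × A))
    {P : Plan Rel ar V A} (h : p P)
    (hs : ∀ Q : Plan Rel ar V A, ∀ e ∈ J, p Q → p (select (.ne e.1 e.2) Q)) :
    p (selectNe J P) := by
  have key : ∀ l : List (A × A), (∀ e ∈ l, e ∈ J) →
      p (l.foldr (fun e Q => select (.ne e.1 e.2) Q) P) := by
    intro l
    induction l with
    | nil => exact fun _ => h
    | cons e l ih =>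
      exact fun hl => hs _ e (hl e (by simp)) (ih fun e' he' => hl e' (by simp [he']))
  exact key _ fun e he => Finset.mem_toList.1 he

theorem atts_selectNe (J : Finset (A × A)) (P : Plan Rel ar V A) :
    (selectNe J P).atts = P.atts :=
  selectNe_induction (p := fun Q => Q.atts = P.atts) J rfl fun _ _ _ h => h

theorem leafAtts_selectNe (J : Finset (A × A)) (P : Plan Rel ar V A) :
    (selectNe J P).leafAtts = P.leafAtts :=
  selectNe_induction (p := fun Q => Q.leafAtts = P.leafAtts) J rfl fun _ _ _ h => h

theorem wellFormed_selectNe {J : Finset (A × A)} {P : Plan Rel ar V A} (h : P.WellFormed)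
    (hJ : ∀ e ∈ J, e.1 ∈ P.atts ∧ e.2 ∈ P.atts) : (selectNe J P).WellFormed :=
  (selectNe_induction (p := fun Q => Q.WellFormed ∧ Q.atts = P.atts) J ⟨h, rfl⟩
    fun _ e he h => ⟨⟨h.1, h.2 ▸ (hJ e he).1, h.2 ▸ (hJ e he).2⟩, h.2⟩).1

theorem leafAtts_pushIneqs (J : Finset (A × A)) (P : Plan Rel ar V A) :
    (pushIneqs J P).leafAtts = P.leafAtts := by
  induction P with
  | base r att => exact leafAtts_selectNe _ _
  | select θ P ih => exact ih
  | project X P ih => exact ih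
  | hproject X E P ih => exact ih
  | join on P Q ihP ihQ =>
    rw [pushIneqs, leafAtts_selectNe, leafAtts, leafAtts, ihP, ihQ]

/-- No attribute is ever lost, because `H`-projections do not truncate. -/
theorem atts_pushIneqs (J : Finset (A × A)) (P : Plan Rel ar V A) :
    (pushIneqs J P).atts = P.leafAtts := by
  induction P with
  | base r att => exact atts_selectNe _ _
  | select θ P ih => exact ih
  | project X P ih => exact ih
  | hproject X E P ih => exact ih
  | join on P Q ihP ihQ =>
    rw [pushIneqs, atts_selectNe, leafAtts, atts, ihP, ihQ]

theorem wellFormed_pushIneqs (J : Finset (A × A)) {P : Plan Rel ar V A} (hs : P.IsSPJ)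
    (h : P.WellFormed) : (pushIneqs J P).WellFormed := by
  classical
  induction P with
  | base r att => exact wellFormed_selectNe h fun e he => (Finset.mem_filter.1 he).2
  | select θ P ih =>
    have h' := wellFormed_of_select h
    refine wellFormed_select_of_subset h (ih (isSPJ_of_select hs) h') ?_
    rw [atts_pushIneqs]
    exact atts_subset_leafAtts h'
  | project X P ih =>
    refine ⟨ih hs h.1, ?_, fun e he => ?_⟩ <;> rw [atts_pushIneqs]
    · exact h.2.trans (atts_subset_leafAtts h.1)
    · exact (Finset.mem_filter.1 he).2
  | hproject X E P ih => exact hs.elim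
  | join on P Q ihP ihQ =>
    refine wellFormed_selectNe ⟨ihP hs.1 h.1, ihQ hs.2 h.2.1, ?_, fun e he => ?_⟩ fun e he => ?_
    · rw [leafAtts_pushIneqs, leafAtts_pushIneqs]
      exact h.2.2.1
    · rw [atts_pushIneqs, atts_pushIneqs]
      have := h.2.2.2 e he
      exact ⟨atts_subset_leafAtts h.1 this.1, atts_subset_leafAtts h.2.1 this.2⟩
    · rw [atts, atts_pushIneqs, atts_pushIneqs, Finset.mem_union, Finset.mem_union]
      rcases (Finset.mem_filter.1 he).2 with h' | h'
      · exact ⟨Or.inl h'.1, Or.inr h'.2⟩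
      · exact ⟨Or.inr h'.1, Or.inl h'.2⟩

/-! ### Evaluation of the transformed plan -/

section Eval

variable (D : Database Rel ar V)

theorem mem_eval_select {θ : Cond V A} {P : Plan Rel ar V A} {t : Tup V A} :
    t ∈ (select θ P).eval D ↔ t ∈ P.eval D ∧ θ.Holds t := by
  classical
  change t ∈ (runSelect θ (P.eval D)).1 ↔ _
  rw [runSelect_fst, List.mem_filter, decide_eq_true_eq]

theorem mem_eval_join {on : List (A × A)} {P Q : Plan Rel ar V A} {u : Tup V A} :
    u ∈ (join on P Q).eval D ↔ ∃ t ∈ P.eval D, ∃ s ∈ Q.eval D,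
      (∀ e ∈ on, t e.1 = s e.2) ∧ u = t.concat s :=
  mem_runJoin on _ _ u

theorem mem_eval_project {X : Finset A} {P : Plan Rel ar V A} {u : Tup V A} :
    u ∈ (project X P).eval D ↔ ∃ t ∈ P.eval D, t.restrict X = u := by
  change u ∈ (runProject X ∅ (P.eval D)).1 ↔ _
  rw [mem_runProject]
  simp

theorem eval_select_sublist (θ : Cond V A) (P : Plan Rel ar V A) :
    ((select θ P).eval D).Sublist (P.eval D) := by
  classical
  change ((runSelect θ (P.eval D)).1).Sublist _
  rw [runSelect_fst]
  exact List.filter_sublist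

theorem eval_selectNe_sublist (J : Finset (A × A)) (P : Plan Rel ar V A) :
    ((selectNe J P).eval D).Sublist (P.eval D) :=
  selectNe_induction (p := fun Q => (Q.eval D).Sublist (P.eval D)) J (List.Sublist.refl _)
    fun Q e _ h => (eval_select_sublist D (.ne e.1 e.2) Q).trans h

theorem mem_eval_selectNe {J : Finset (A × A)} {P : Plan Rel ar V A} {t : Tup V A} :
    t ∈ (selectNe J P).eval D ↔ t ∈ P.eval D ∧ ∀ e ∈ J, t e.1 ≠ t e.2 := by
  have key : ∀ l : List (A × A), t ∈ (l.foldr (fun e Q => select (.ne e.1 e.2) Q) P).eval D ↔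
      t ∈ P.eval D ∧ ∀ e ∈ l, t e.1 ≠ t e.2 := by
    intro l
    induction l with
    | nil => simp
    | cons e l ih =>
      rw [List.foldr_cons, mem_eval_select, ih, List.forall_mem_cons, and_assoc, Cond.Holds,
        and_comm (a := t e.1 ≠ t e.2)]
  have h := key J.toList
  simp only [Finset.mem_toList] at h
  exact h

theorem time_selectNe_le (J : Finset (A × A)) (P : Plan Rel ar V A) :
    (selectNe J P).time D ≤ P.time D + J.card * (3 * (P.eval D).length + 1) := by
  have key : ∀ l : List (A × A),
      ((l.foldr (fun e Q => select (.ne e.1 e.2) Q) P).eval D).length ≤ (P.eval D).length ∧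
      (l.foldr (fun e Q => select (.ne e.1 e.2) Q) P).time D ≤
        P.time D + l.length * (3 * (P.eval D).length + 1) := by
    intro l
    induction l with
    | nil => simp
    | cons e l ih =>
      set Q := l.foldr (fun e Q => select (.ne e.1 e.2) Q) P
      have h1 := (eval_select_sublist D (.ne e.1 e.2) Q).length_le
      have h2 : (select (.ne e.1 e.2) Q).time D =
        Q.time D + (runSelect (.ne e.1 e.2) (Q.eval D)).2 + 1 := rfl
      have h3 := runSelect_snd_le (.ne e.1 e.2) (Q.eval D)
      rw [List.foldr_cons, List.length_cons, add_mul, one_mul]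
      refine ⟨h1.trans ih.1, ?_⟩
      change (select (.ne e.1 e.2) Q).time D ≤ _
      omega
  have h := (key J.toList).2
  rw [Finset.length_toList] at h
  exact h

theorem hasSupport_of_mem_eval_base {r : Rel} {att : Fin (ar r) → A}
    (h : Function.Injective att) {t : Tup V A} (ht : t ∈ (base r att).eval D) :
    t.HasSupport (base r att : Plan Rel ar V A).leafAtts := by
  classical
  obtain ⟨s, -, rfl⟩ := List.mem_map.1 ht
  intro a
  rw [leafAtts, Finset.mem_image]
  constructor
  · intro ha
    by_contra hn
    refine ha (Function.extend_apply' _ _ _ ?_)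
    rintro ⟨i, hi⟩
    exact hn ⟨i, Finset.mem_univ i, hi⟩
  · rintro ⟨i, -, rfl⟩
    rw [h.extend_apply]
    simp

theorem nodup_eval_base {r : Rel} {att : Fin (ar r) → A} (h : Function.Injective att) :
    ((base r att).eval D).Nodup := by
  refine (D.nodup r).map fun s s' hss => ?_
  funext i
  have := congrFun hss (att i)
  simpa [h.extend_apply] using this

theorem hasSupport_of_mem_eval_dropProj {P : Plan Rel ar V A} (h : P.WellFormed) :
    ∀ t ∈ P.dropProj.eval D, t.HasSupport P.leafAtts := by
  induction P with
  | base r att => exact fun t ht => hasSupport_of_mem_eval_base D h ht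
  | select θ P ih => exact fun t ht => ih (wellFormed_of_select h) t ((mem_eval_select D).1 ht).1
  | project X P ih => exact ih h.1
  | hproject X E P ih => exact ih h.1
  | join on P Q ihP ihQ =>
    intro u hu
    obtain ⟨t, ht, s, hs, -, rfl⟩ := (mem_eval_join D).1 hu
    exact (ihP h.1 t ht).concat (ihQ h.2.1 s hs)

/-- Soundness: the transformed plan only outputs tuples of the projection-free plan that satisfy
the inequalities between their attributes. -/
theorem mem_dropProj_of_mem_eval_pushIneqs (J : Finset (A × A)) {P : Plan Rel ar V A}
    (hs : P.IsSPJ) (h : P.WellFormed) : ∀ t ∈ (pushIneqs J P).eval D, t ∈ P.dropProj.eval D ∧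
      ∀ e ∈ J, e.1 ∈ P.leafAtts → e.2 ∈ P.leafAtts → t e.1 ≠ t e.2 := by
  classical
  induction P with
  | base r att =>
    intro t ht
    obtain ⟨h1, h2⟩ := (mem_eval_selectNe D).1 ht
    exact ⟨h1, fun e he h3 h4 => h2 e (Finset.mem_filter.2 ⟨he, h3, h4⟩)⟩
  | select θ P ih =>
    intro t ht
    obtain ⟨h1, h2⟩ := (mem_eval_select D).1 ht
    have h3 := ih (isSPJ_of_select hs) (wellFormed_of_select h) t h1
    exact ⟨(mem_eval_select D).2 ⟨h3.1, h2⟩, h3.2⟩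
  | project X P ih =>
    exact fun t ht => ih hs h.1 t ((runHProject_sublist _ _ _ _).subset ht)
  | hproject X E P ih => exact hs.elim
  | join on P Q ihP ihQ =>
    intro u hu
    obtain ⟨h1, h2⟩ := (mem_eval_selectNe D).1 hu
    obtain ⟨t, ht, s, hs', hts, rfl⟩ := (mem_eval_join D).1 h1
    obtain ⟨ht1, ht2⟩ := ihP hs.1 h.1 t ht
    obtain ⟨hs1, hs2⟩ := ihQ hs.2 h.2.1 s hs'
    have hsup := hasSupport_of_mem_eval_dropProj D h.1 t ht1
    refine ⟨(mem_eval_join D).2 ⟨t, ht1, s, hs1, hts, rfl⟩, fun e he h3 h4 => ?_⟩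
    rw [leafAtts, Finset.mem_union] at h3 h4
    rcases h3 with h3 | h3 <;> rcases h4 with h4 | h4
    · rw [Tup.concat_apply_left hsup h3, Tup.concat_apply_left hsup h4]
      exact ht2 e he h3 h4
    · exact h2 e (Finset.mem_filter.2 ⟨he, Or.inl ⟨h3, h4⟩⟩)
    · exact h2 e (Finset.mem_filter.2 ⟨he, Or.inr ⟨h3, h4⟩⟩)
    · rw [Tup.concat_apply_right hsup h.2.2.1 h3, Tup.concat_apply_right hsup h.2.2.1 h4]
      exact hs2 e he h3 h4

theorem hasSupport_of_mem_eval_pushIneqs (J : Finset (A × A)) {P : Plan Rel ar V A}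
    (hs : P.IsSPJ) (h : P.WellFormed) : ∀ t ∈ (pushIneqs J P).eval D, t.HasSupport P.leafAtts :=
  fun t ht => hasSupport_of_mem_eval_dropProj D h t
    (mem_dropProj_of_mem_eval_pushIneqs D J hs h t ht).1

open scoped Classical in
/-- Completeness: a tuple of the projection-free plan that satisfies the inequalities inside the
plan and, with the values `v`, those that leave the plan, is represented by such a tuple in the
output of the transformed plan. -/
theorem exists_mem_eval_pushIneqs (J : Finset (A × A)) {P : Plan Rel ar V A}
    (hs : P.IsSPJ) (h : P.WellFormed) : ∀ t ∈ P.dropProj.eval D,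
      (∀ e ∈ J, e.1 ∈ P.leafAtts → e.2 ∈ P.leafAtts → t e.1 ≠ t e.2) →
      ∀ v : Tup V A, (∀ e ∈ J ∪ J.image Prod.swap, e.1 ∈ P.leafAtts → e.2 ∉ P.leafAtts →
        t e.1 ≠ v e.2) →
      ∃ t' ∈ (pushIneqs J P).eval D, (∀ a ∈ P.atts, t' a = t a) ∧
        ∀ e ∈ J ∪ J.image Prod.swap, e.1 ∈ P.leafAtts → e.2 ∉ P.leafAtts → t' e.1 ≠ v e.2 := by
  induction P with
  | base r att =>
    intro t ht hin v hv
    exact ⟨t, (mem_eval_selectNe D).2 ⟨ht, fun e he => by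
      obtain ⟨h1, h2, h3⟩ := Finset.mem_filter.1 he
      exact hin e h1 h2 h3⟩, fun _ _ => rfl, hv⟩
  | select θ P ih =>
    intro t ht hin v hv
    obtain ⟨h1, h2⟩ := (mem_eval_select D).1 ht
    obtain ⟨t', ht', h3, h4⟩ := ih (isSPJ_of_select hs) (wellFormed_of_select h) t h1 hin v hv
    exact ⟨t', (mem_eval_select D).2 ⟨ht', (holds_congr_of_wellFormed h h3).2 h2⟩, h3, h4⟩
  | project X P ih =>
    intro t ht hin v hv
    obtain ⟨t₁, ht₁, h3, h4⟩ := ih hs h.1 t ht hin v hv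
    obtain ⟨t', ht', h5, h6⟩ := exists_mem_runHProject (X := X)
      (E := (J ∪ J.image Prod.swap).filter fun e =>
        (e.1 ∈ P.leafAtts ∧ e.1 ∉ X) ∧ e.2 ∉ P.leafAtts) (v := v) (t₀ := t₁)
      (fun e he => by
        obtain ⟨h1, h2, h3⟩ := Finset.mem_filter.1 he
        exact h4 e h1 h2.1 h3) _ (fun _ => [fun _ => none]) ht₁
      -- The root carries no values, so every `v` fits below it.
      ⟨fun _ => none, by simp, fun a ha => absurd rfl ha⟩
    rw [Tup.restrict_eq_restrict_iff] at h5
    refine ⟨t', ht', fun a ha => (h5 a ha).trans (h3 a (h.2 ha)), fun e he h7 h8 => ?_⟩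
    by_cases hX : e.1 ∈ X
    · rw [h5 _ hX]
      exact h4 e he h7 h8
    · exact h6 e (Finset.mem_filter.2 ⟨he, ⟨h7, hX⟩, h8⟩)
  | hproject X E P ih => exact hs.elim
  | join on P Q ihP ihQ =>
    have hswap : ∀ e ∈ J ∪ J.image Prod.swap, e.swap ∈ J ∪ J.image Prod.swap := by
      intro e he
      rcases Finset.mem_union.1 he with he | he
      · exact Finset.mem_union_right _ (Finset.mem_image_of_mem _ he)
      · obtain ⟨e', he', rfl⟩ := Finset.mem_image.1 he
        exact Finset.mem_union_left _ (by rwa [Prod.swap_swap])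
    intro u hu hin v hv
    obtain ⟨t, ht, s, hs', hts, rfl⟩ := (mem_eval_join D).1 hu
    have hsup := hasSupport_of_mem_eval_dropProj D h.1 t ht
    have hdisj := h.2.2.1
    have hl : ∀ a ∈ P.leafAtts, t.concat s a = t a := fun a ha =>
      Tup.concat_apply_left hsup ha
    have hr : ∀ a ∈ Q.leafAtts, t.concat s a = s a := fun a ha =>
      Tup.concat_apply_right hsup hdisj ha
    simp only [leafAtts, Finset.mem_union (s := P.leafAtts), not_or] at hin hv ⊢
    have hin' : ∀ e ∈ J ∪ J.image Prod.swap, e.1 ∈ P.leafAtts → e.2 ∈ Q.leafAtts →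
        t e.1 ≠ s e.2 := by
      intro e he h1 h2
      rcases Finset.mem_union.1 he with he | he
      · have := hin e he (Or.inl h1) (Or.inr h2)
        rwa [hl _ h1, hr _ h2] at this
      · obtain ⟨e', he', rfl⟩ := Finset.mem_image.1 he
        have := hin e' he' (Or.inr h2) (Or.inl h1)
        simp only [Prod.fst_swap, Prod.snd_swap] at h1 h2 ⊢
        rw [hr _ h2, hl _ h1] at this
        exact this.symm
    obtain ⟨t', ht', ht1, ht2⟩ := ihP hs.1 h.1 t ht
      (fun e he h1 h2 => by
        have := hin e he (Or.inl h1) (Or.inl h2)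
        rwa [hl _ h1, hl _ h2] at this)
      -- For the left side, the outside consists of the right tuple and of `v`.
      (fun a => if a ∈ Q.leafAtts then s a else v a)
      (fun e he h1 h2 => by
        by_cases h3 : e.2 ∈ Q.leafAtts
        · simp only [h3, if_true]
          exact hin' e he h1 h3
        · simp only [h3, if_false]
          have := hv e he (Or.inl h1) ⟨h2, h3⟩
          rwa [hl _ h1] at this)
    obtain ⟨s', hs'', hs1, hs2⟩ := ihQ hs.2 h.2.1 s hs'
      (fun e he h1 h2 => by
        have := hin e he (Or.inr h1) (Or.inr h2)
        rwa [hr _ h1, hr _ h2] at this)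
      -- The right side is replaced against the new left tuple `t'`, not against `t`; otherwise the
      -- two representatives might violate an inequality between them.
      (fun a => if a ∈ P.leafAtts then t' a else v a)
      (fun e he h1 h2 => by
        by_cases h3 : e.2 ∈ P.leafAtts
        · simp only [h3, if_true]
          have := ht2 e.swap (hswap e he) h3 (Finset.disjoint_right.1 hdisj h1)
          simp only [Prod.fst_swap, Prod.snd_swap, h1, if_true] at this
          exact this.symm
        · simp only [h3, if_false]
          have := hv e he (Or.inr h1) ⟨h3, h2⟩
          rwa [hr _ h1] at this)
    have hsup' := hasSupport_of_mem_eval_pushIneqs D J hs.1 h.1 t' ht'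
    have hl' : ∀ a ∈ P.leafAtts, t'.concat s' a = t' a := fun a ha =>
      Tup.concat_apply_left hsup' ha
    have hr' : ∀ a ∈ Q.leafAtts, t'.concat s' a = s' a := fun a ha =>
      Tup.concat_apply_right hsup' hdisj ha
    have hcross : ∀ e ∈ J ∪ J.image Prod.swap, e.1 ∈ Q.leafAtts → e.2 ∈ P.leafAtts →
        s' e.1 ≠ t' e.2 := by
      intro e he h1 h2
      have := hs2 e he h1 (Finset.disjoint_left.1 hdisj h2)
      simpa only [h2, if_true] using this
    refine ⟨t'.concat s', (mem_eval_selectNe D).2 ⟨(mem_eval_join D).2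
      ⟨t', ht', s', hs'', fun e he => ?_, rfl⟩, fun e he => ?_⟩, fun a ha => ?_, ?_⟩
    · have := h.2.2.2 e he
      rw [ht1 _ this.1, hs1 _ this.2, hts e he]
    · obtain ⟨he, ⟨h1, h2⟩ | ⟨h1, h2⟩⟩ := Finset.mem_filter.1 he
      · rw [hl' _ h1, hr' _ h2]
        exact (hcross e.swap (hswap e (Finset.mem_union_left _ he)) h2 h1).symm
      · rw [hr' _ h1, hl' _ h2]
        exact hcross e (Finset.mem_union_left _ he) h1 h2
    · rcases Finset.mem_union.1 ha with ha | ha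
      · have := atts_subset_leafAtts h.1 ha
        rw [hl' _ this, hl _ this, ht1 _ ha]
      · have := atts_subset_leafAtts h.2.1 ha
        rw [hr' _ this, hr _ this, hs1 _ ha]
    · rintro e he (h1 | h1) ⟨h2, h3⟩
      · rw [hl' _ h1]
        have := ht2 e he h1 h2
        simpa only [h3, if_false] using this
      · rw [hr' _ h1]
        have := hs2 e he h1 h3
        simpa only [h2, if_false] using this

end Eval

end Plan

/-! ### Output sizes and running time of the transformed plan -/

open scoped Classical in
theorem leafWeight_root_le {V : Type v} {A : Type x} (E : Finset (A × A)) :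
    leafWeight E [(fun _ => none : Tup V A)] ≤ (E.card + 1) ^ (E.image Prod.snd).card := by
  simp [leafWeight, leafRank]

namespace Plan

variable {Rel : Type u} {ar : Rel → ℕ} {V : Type v} {Var : Type w} {A : Type x}

section Cost

variable (D : Database Rel ar V)

/-- Selections and join conditions only inspect attributes that the original subplan still has, so
restriction commutes with every operator. -/
theorem restrict_mem_eval (J : Finset (A × A)) {P : Plan Rel ar V A}
    (hs : P.IsSPJ) (h : P.WellFormed) :
    ∀ t ∈ (pushIneqs J P).eval D, t.restrict P.atts ∈ P.eval D := by
  classical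
  induction P with
  | base r att =>
    intro t ht
    have ht' := ((mem_eval_selectNe D).1 ht).1
    rw [show t.restrict (base r att : Plan Rel ar V A).atts = t from
      Tup.restrict_eq_self (hasSupport_of_mem_eval_base D h ht')]
    exact ht'
  | select θ P ih =>
    intro t ht
    obtain ⟨h1, h2⟩ := (mem_eval_select D).1 ht
    refine (mem_eval_select D).2 ⟨ih (isSPJ_of_select hs) (wellFormed_of_select h) t h1, ?_⟩
    exact (holds_congr_of_wellFormed h fun a ha => Tup.restrict_apply_of_mem ha t).2 h2
  | project X P ih =>
    intro t ht
    exact (mem_eval_project D).2 ⟨_, ih hs h.1 t ((runHProject_sublist _ _ _ _).subset ht),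
      Tup.restrict_restrict_of_subset h.2 t⟩
  | hproject X E P ih => exact hs.elim
  | join on P Q ihP ihQ =>
    intro u hu
    obtain ⟨t, ht, s, hs', hts, rfl⟩ := (mem_eval_join D).1 ((mem_eval_selectNe D).1 hu).1
    refine (mem_eval_join D).2 ⟨_, ihP hs.1 h.1 t ht, _, ihQ hs.2 h.2.1 s hs', fun e he => ?_, ?_⟩
    · have := h.2.2.2 e he
      rw [Tup.restrict_apply_of_mem this.1, Tup.restrict_apply_of_mem this.2, hts e he]
    · exact Tup.restrict_concat (hasSupport_of_mem_eval_pushIneqs D J hs.1 h.1 t ht) h.2.2.1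
        (atts_subset_leafAtts h.1) (atts_subset_leafAtts h.2.1)

-- The fibre over `r` embeds in the product of the fibres over the restrictions of `r` to the two
-- sides.
open scoped Classical in
theorem countP_eval_join_le {J : Finset (A × A)} {on : List (A × A)} {P Q : Plan Rel ar V A}
    (hs : (join on P Q).IsSPJ) (h : (join on P Q).WellFormed) {m n : ℕ}
    (hm : ∀ r, ((pushIneqs J P).eval D).countP (fun t => decide (t.restrict P.atts = r)) ≤ m)
    (hn : ∀ r, ((pushIneqs J Q).eval D).countP (fun t => decide (t.restrict Q.atts = r)) ≤ n)
    (r : Tup V A) :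
    ((join on (pushIneqs J P) (pushIneqs J Q)).eval D).countP
      (fun t => decide (t.restrict (join on P Q).atts = r)) ≤ m * n := by
  refine (countP_runJoin_le on _ _ _
    (fun t => decide (t.restrict P.atts = r.restrict P.atts))
    (fun t => decide (t.restrict Q.atts = r.restrict Q.atts)) ?_).trans
    (Nat.mul_le_mul (hm _) (hn _))
  intro t ht s hs' hr
  have hsup := hasSupport_of_mem_eval_pushIneqs D J hs.1 h.1 t ht
  have hr := of_decide_eq_true hr
  subst hr
  have hP : P.atts ⊆ (join on P Q).atts := Finset.subset_union_left
  have hQ : Q.atts ⊆ (join on P Q).atts := Finset.subset_union_right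
  rw [decide_eq_true_eq, decide_eq_true_eq, Tup.restrict_restrict_of_subset hP,
    Tup.restrict_restrict_of_subset hQ, Tup.restrict_eq_restrict_iff,
    Tup.restrict_eq_restrict_iff]
  exact ⟨fun a ha => (Tup.concat_apply_left hsup (atts_subset_leafAtts h.1 ha)).symm,
    fun a ha => (Tup.concat_apply_right hsup h.2.2.1 (atts_subset_leafAtts h.2.1 ha)).symm⟩

variable {D}

open scoped Classical in
/-- The edges of the graph used for a projection. -/
noncomputable def projEdges (J : Finset (A × A)) (X : Finset A) (P : Plan Rel ar V A) :
    Finset (A × A) :=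
  (J ∪ J.image Prod.swap).filter fun e => (e.1 ∈ P.leafAtts ∧ e.1 ∉ X) ∧ e.2 ∉ P.leafAtts

theorem projEdges_mem {J : Finset (A × A)} {W : Finset A} (hW : ∀ e ∈ J, e.1 ∈ W ∧ e.2 ∈ W)
    {X : Finset A} {P : Plan Rel ar V A} {e : A × A} (he : e ∈ projEdges J X P) :
    e.1 ∈ W ∧ e.2 ∈ W ∧ e.1 ∈ P.leafAtts := by
  classical
  obtain ⟨h1, ⟨h2, -⟩, -⟩ := Finset.mem_filter.1 he
  rcases Finset.mem_union.1 h1 with h1 | h1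
  · exact ⟨(hW e h1).1, (hW e h1).2, h2⟩
  · obtain ⟨e', he', rfl⟩ := Finset.mem_image.1 h1
    exact ⟨(hW e' he').2, (hW e' he').1, h2⟩

variable (D)

-- Exponents add at a join because the two sides share no attribute. At a projection the bound for
-- the subplan is discarded: the graph alone bounds the group, and its left vertices lie in
-- `P.leafAtts ∩ W`.
open scoped Classical in
theorem countP_eval_pushIneqs_le {J : Finset (A × A)} {W : Finset A}
    (hW : ∀ e ∈ J, e.1 ∈ W ∧ e.2 ∈ W) {P : Plan Rel ar V A} (hs : P.IsSPJ) (h : P.WellFormed) :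
    ∀ r, ((pushIneqs J P).eval D).countP (fun t => decide (t.restrict P.atts = r)) ≤
      (W.card + 1) ^ (P.leafAtts ∩ W).card := by
  induction P with
  | base r att =>
    intro s
    refine ((eval_selectNe_sublist D _ _).countP_le).trans ?_
    have h1 : ((base r att).eval D).countP
        (fun t => decide (t.restrict (base r att : Plan Rel ar V A).atts = s)) =
        ((base r att).eval D).count s := by
      refine List.countP_congr fun t ht => ?_
      rw [show t.restrict (base r att : Plan Rel ar V A).atts = t from
        Tup.restrict_eq_self (hasSupport_of_mem_eval_base D h ht)]
      simp
    rw [h1]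
    exact (List.nodup_iff_count_le_one.1 (nodup_eval_base D h) s).trans (Nat.one_le_pow _ _ (by simp))
  | select θ P ih =>
    exact fun r => ((eval_select_sublist D θ _).countP_le).trans
      (ih (isSPJ_of_select hs) (wellFormed_of_select h) r)
  | project X P ih =>
    intro r
    have hE := fun e he => projEdges_mem hW (X := X) (P := P) (e := e) he
    refine (countP_runHProject_le (E := projEdges J X P) r _ fun t ht e he => ?_).trans ?_
    · exact (hasSupport_of_mem_eval_pushIneqs D J (P := P) hs h.1 t ht _).2 (hE e he).2.2
    · refine (Nat.pow_le_pow_left (Nat.succ_le_succ (Finset.card_le_card ?_)) _).trans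
        (Nat.pow_le_pow_right (by simp) (Finset.card_le_card ?_))
      · exact Finset.image_subset_iff.2 fun e he => (hE e he).2.1
      · exact Finset.image_subset_iff.2 fun e he =>
          Finset.mem_inter.2 ⟨(hE e he).2.2, (hE e he).1⟩
  | hproject X E P ih => exact hs.elim
  | join on P Q ihP ihQ =>
    intro r
    refine ((eval_selectNe_sublist D _ _).countP_le).trans
      ((countP_eval_join_le D hs h (ihP hs.1 h.1) (ihQ hs.2 h.2.1) r).trans_eq ?_)
    rw [← pow_add, leafAtts, Finset.union_inter_distrib_right, Finset.card_union_of_disjoint]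
    exact h.2.2.1.mono Finset.inter_subset_left Finset.inter_subset_left

theorem length_eval_pushIneqs_le {J : Finset (A × A)} {W : Finset A}
    (hW : ∀ e ∈ J, e.1 ∈ W ∧ e.2 ∈ W) {P : Plan Rel ar V A} (hs : P.IsSPJ) (h : P.WellFormed) :
    ((pushIneqs J P).eval D).length ≤ (W.card + 1) ^ W.card * (P.eval D).length := by
  classical
  refine List.length_le_mul_of_countP_le (fun t => t.restrict P.atts) _ _ _
    (restrict_mem_eval D J hs h) fun r => (countP_eval_pushIneqs_le D hW hs h r).trans ?_
  exact Nat.pow_le_pow_right (by simp) (Finset.card_le_card Finset.inter_subset_right)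

/-- The join writes its matches before the inequality selections discard any, so its cost requires a
bound on the unfiltered output. -/
theorem length_eval_join_pushIneqs_le {J : Finset (A × A)} {W : Finset A}
    (hW : ∀ e ∈ J, e.1 ∈ W ∧ e.2 ∈ W) {on : List (A × A)} {P Q : Plan Rel ar V A}
    (hs : (join on P Q).IsSPJ) (h : (join on P Q).WellFormed) :
    ((join on (pushIneqs J P) (pushIneqs J Q)).eval D).length ≤
      (W.card + 1) ^ W.card * ((join on P Q).eval D).length := by
  classical
  refine List.length_le_mul_of_countP_le (fun t => t.restrict (join on P Q).atts) _ _ _ ?_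
    fun r => (countP_eval_join_le D hs h (countP_eval_pushIneqs_le D hW hs.1 h.1)
      (countP_eval_pushIneqs_le D hW hs.2 h.2.1) r).trans ?_
  · intro u hu
    obtain ⟨t, ht, s, hs', hts, rfl⟩ := (mem_eval_join D).1 hu
    refine (mem_eval_join D).2 ⟨_, restrict_mem_eval D J hs.1 h.1 t ht, _,
      restrict_mem_eval D J hs.2 h.2.1 s hs', fun e he => ?_, ?_⟩
    · have := h.2.2.2 e he
      rw [Tup.restrict_apply_of_mem this.1, Tup.restrict_apply_of_mem this.2, hts e he]
    · exact Tup.restrict_concat (hasSupport_of_mem_eval_pushIneqs D J hs.1 h.1 t ht) h.2.2.1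
        (atts_subset_leafAtts h.1) (atts_subset_leafAtts h.2.1)
  · rw [← pow_add, ← Finset.card_union_of_disjoint
      (h.2.2.1.mono Finset.inter_subset_left Finset.inter_subset_left)]
    exact Nat.pow_le_pow_right (by simp) (Finset.card_le_card
      (Finset.union_subset Finset.inter_subset_right Finset.inter_subset_right))

theorem card_le_sq_of_endpoints {E : Finset (A × A)} {W : Finset A}
    (hW : ∀ e ∈ E, e.1 ∈ W ∧ e.2 ∈ W) : E.card ≤ W.card ^ 2 := by
  rw [sq, ← Finset.card_product]
  exact Finset.card_le_card fun e he => Finset.mem_product.2 (hW e he)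

/-- With `k = W.card`, a tree has at most `(k ^ 2 + 1) ^ k` leaves, and processing one takes at most
`2 * (k ^ 2 + 1)` steps. The 4 further steps per tuple raise the factor 2 to 6. -/
theorem time_hproject_pushIneqs_le {J : Finset (A × A)} {W : Finset A}
    (hW : ∀ e ∈ J, e.1 ∈ W ∧ e.2 ∈ W) {X : Finset A} {P : Plan Rel ar V A} (hs : P.IsSPJ)
    (h : P.WellFormed) : (pushIneqs J (project X P)).time D ≤ (pushIneqs J P).time D +
      ((pushIneqs J P).eval D).length * (6 * (W.card ^ 2 + 1) ^ (W.card + 1)) + 1 := by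
  classical
  have hE := fun e he => projEdges_mem hW (X := X) (P := P) (e := e) he
  have h1 := runHProject_time_le (X := X) (E := projEdges J X P) ((pushIneqs J P).eval D)
    (fun _ => [fun _ => none]) (L := (W.card ^ 2 + 1) ^ W.card)
    (fun t ht e he => (hasSupport_of_mem_eval_pushIneqs D J hs h t ht _).2 (hE e he).2.2) (by
      intro r
      refine (leafWeight_root_le _).trans ((Nat.pow_le_pow_left (Nat.succ_le_succ
        (card_le_sq_of_endpoints fun e he => ⟨(hE e he).1, (hE e he).2.1⟩)) _).trans
        (Nat.pow_le_pow_right (by simp) (Finset.card_le_card ?_)))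
      exact Finset.image_subset_iff.2 fun e he => (hE e he).2.1)
  have h2 : (projEdges J X P).card ≤ W.card ^ 2 :=
    card_le_sq_of_endpoints fun e he => ⟨(hE e he).1, (hE e he).2.1⟩
  have h3 : (W.card ^ 2 + 1) ^ W.card * (2 + 2 * (projEdges J X P).card) + 4 ≤
      6 * (W.card ^ 2 + 1) ^ (W.card + 1) := by
    have h4 : 1 ≤ (W.card ^ 2 + 1) ^ (W.card + 1) := Nat.one_le_pow _ _ (by simp)
    have h5 : (W.card ^ 2 + 1) ^ W.card * (2 + 2 * (projEdges J X P).card) ≤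
        (W.card ^ 2 + 1) ^ W.card * (2 * (W.card ^ 2 + 1)) :=
      Nat.mul_le_mul_left _ (by omega)
    rw [pow_succ (W.card ^ 2 + 1) W.card] at h4 ⊢
    linarith
  have h6 : (pushIneqs J (project X P)).time D = (pushIneqs J P).time D +
    (runHProject X (projEdges J X P) (fun _ => [fun _ => none]) ((pushIneqs J P).eval D)).2 + 1 :=
    rfl
  have h7 := Nat.mul_le_mul_left ((pushIneqs J P).eval D).length h3
  omega

/-- The output length is added to the time because reading a base relation is charged to the
operator above it. In the induction, the two original steps per input tuple yield twice `6 * K`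
times the input length: one half absorbs the length term of the induction hypothesis, the other pays
for the new operator. -/
theorem time_pushIneqs_le {J : Finset (A × A)} {W : Finset A}
    (hW : ∀ e ∈ J, e.1 ∈ W ∧ e.2 ∈ W) {P : Plan Rel ar V A} (hs : P.IsSPJ) (h : P.WellFormed) :
    (pushIneqs J P).time D ≤
      6 * ((W.card + 1) ^ W.card * (W.card ^ 2 + 1) ^ (W.card + 1)) *
        (P.time D + (P.eval D).length) := by
  classical
  have hc : 1 ≤ (W.card + 1) ^ W.card := Nat.one_le_pow _ _ (by simp)
  have hM : W.card ^ 2 + 1 ≤ (W.card ^ 2 + 1) ^ (W.card + 1) :=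
    Nat.le_self_pow (by simp) _
  have hJ := card_le_sq_of_endpoints hW
  have hlen := fun (P : Plan Rel ar V A) => length_eval_pushIneqs_le D hW (P := P)
  have hjoin := fun (on : List (A × A)) (P Q : Plan Rel ar V A) =>
    length_eval_join_pushIneqs_le D hW (on := on) (P := P) (Q := Q)
  have hproj := fun (X : Finset A) (P : Plan Rel ar V A) =>
    time_hproject_pushIneqs_le D hW (X := X) (P := P)
  revert hlen hjoin hproj
  generalize (W.card + 1) ^ W.card = c at *
  generalize (W.card ^ 2 + 1) ^ (W.card + 1) = N at *
  intro hlen hjoin hproj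
  have hN : 1 ≤ N := by omega
  have hcN : c ≤ c * N := Nat.le_mul_of_pos_right _ hN
  have hNc : N ≤ c * N := Nat.le_mul_of_pos_left _ hc
  generalize hK : c * N = K at *
  have hJN : J.card + 1 ≤ N := by omega
  induction P with
  | base r att =>
    have h1 := time_selectNe_le D (J.filter fun e =>
      e.1 ∈ Finset.univ.image att ∧ e.2 ∈ Finset.univ.image att) (base r att)
    have h2 := Finset.card_filter_le J fun e =>
      e.1 ∈ Finset.univ.image att ∧ e.2 ∈ Finset.univ.image att
    have h3 : (base r att).time D = 1 := rfl
    rw [pushIneqs]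
    rw [h3] at h1 ⊢
    refine h1.trans ?_
    generalize ((base r att).eval D).length = S at *
    generalize (J.filter fun e =>
      e.1 ∈ Finset.univ.image att ∧ e.2 ∈ Finset.univ.image att).card = j at *
    have h4 : j * (3 * S + 1) ≤ K * (3 * S + 1) := Nat.mul_le_mul_right _ (by omega)
    nlinarith
  | select θ P ih =>
    have hs' := isSPJ_of_select hs
    have h' := wellFormed_of_select h
    have h1 := ih hs' h'
    have h2 := hlen P hs' h'
    have h3 := runSelect_snd_le θ ((pushIneqs J P).eval D)
    have h4 := two_mul_length_le_runSelect_snd θ (P.eval D)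
    have h5 : (pushIneqs J (select θ P)).time D =
      (pushIneqs J P).time D + (runSelect θ ((pushIneqs J P).eval D)).2 + 1 := rfl
    have h6 : (select θ P).time D = P.time D + (runSelect θ (P.eval D)).2 + 1 := rfl
    rw [h5, h6]
    have h7 : c * (P.eval D).length ≤ K * (P.eval D).length := Nat.mul_le_mul_right _ hcN
    have h8 := Nat.mul_le_mul_left (6 * K) h4
    have h9 : 0 ≤ K * ((select θ P).eval D).length := Nat.zero_le _
    nlinarith
  | project X P ih =>
    have h1 := ih hs h.1
    have h2 := hlen P hs h.1
    have h3 := hproj X P hs h.1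
    have h4 := (runProject_bounds X (P.eval D) ∅).2.1
    have h6 : (project X P).time D = P.time D + (runProject X ∅ (P.eval D)).2 + 1 := rfl
    rw [h6]
    -- This uses up the second half exactly, which is why the constant in the statement is 6.
    have h7 : ((pushIneqs J P).eval D).length * (6 * N) ≤ 6 * (K * (P.eval D).length) := by
      rw [← hK]
      calc _ ≤ c * (P.eval D).length * (6 * N) := Nat.mul_le_mul_right _ h2
        _ = _ := by ring
    have h8 := Nat.mul_le_mul_left (6 * K) h4
    have h9 : 0 ≤ K * ((project X P).eval D).length := Nat.zero_le _
    nlinarith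
  | hproject X E P ih => exact hs.elim
  | join on P Q ihP ihQ =>
    have h1 := ihP hs.1 h.1
    have h2 := ihQ hs.2 h.2.1
    have h3 := hlen P hs.1 h.1
    have h4 := hlen Q hs.2 h.2.1
    have h5 := hjoin on P Q hs h
    have h6 := time_selectNe_le D (J.filter fun e => (e.1 ∈ P.leafAtts ∧ e.2 ∈ Q.leafAtts) ∨
      (e.1 ∈ Q.leafAtts ∧ e.2 ∈ P.leafAtts)) (join on (pushIneqs J P) (pushIneqs J Q))
    have h7 := Finset.card_filter_le J fun e => (e.1 ∈ P.leafAtts ∧ e.2 ∈ Q.leafAtts) ∨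
      (e.1 ∈ Q.leafAtts ∧ e.2 ∈ P.leafAtts)
    have h8 : (join on P Q).time D = P.time D + Q.time D + (2 * (P.eval D).length +
        2 * (Q.eval D).length + ((join on P Q).eval D).length) + 1 := by
      rw [time, run, runJoin_snd]
      rfl
    have h9 : (join on (pushIneqs J P) (pushIneqs J Q)).time D = (pushIneqs J P).time D +
        (pushIneqs J Q).time D + (2 * ((pushIneqs J P).eval D).length +
        2 * ((pushIneqs J Q).eval D).length +
        ((join on (pushIneqs J P) (pushIneqs J Q)).eval D).length) + 1 := by
      rw [time, run, runJoin_snd]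
      rfl
    rw [pushIneqs, h8]
    refine h6.trans ?_
    rw [h9]
    generalize (J.filter fun e => (e.1 ∈ P.leafAtts ∧ e.2 ∈ Q.leafAtts) ∨
      (e.1 ∈ Q.leafAtts ∧ e.2 ∈ P.leafAtts)).card = j at *
    generalize ((join on (pushIneqs J P) (pushIneqs J Q)).eval D).length = s' at *
    generalize ((join on P Q).eval D).length = s at *
    have h10 : c * (P.eval D).length ≤ K * (P.eval D).length := Nat.mul_le_mul_right _ hcN
    have h11 : c * (Q.eval D).length ≤ K * (Q.eval D).length := Nat.mul_le_mul_right _ hcN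
    -- The factor `c` accounts for the larger join output, the factor `N` for writing it and
    -- scanning it once per inequality.
    have h12 : (j + 1) * s' ≤ K * s := by
      rw [← hK]
      calc (j + 1) * s' ≤ N * (c * s) := Nat.mul_le_mul (by omega) h5
        _ = c * N * s := by ring
    nlinarith

/-- The output of a plan is no larger than its running time, unless it is a base relation. -/
theorem length_eval_le [Fintype Rel] {P : Plan Rel ar V A} (hs : P.IsSPJ) :
    (P.eval D).length ≤ max (P.time D) D.size := by
  cases P with
  | base r att =>
    refine le_max_of_le_right ?_
    have : ((base r att).eval D).length = (D.rel r).length := List.length_map _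
    rw [this]
    exact Finset.single_le_sum (f := fun r => (D.rel r).length) (fun _ _ => Nat.zero_le _)
      (Finset.mem_univ r)
  | select θ P =>
    have h1 := length_runSelect_fst_le θ (P.eval D)
    have h2 : (select θ P).time D = P.time D + (runSelect θ (P.eval D)).2 + 1 := rfl
    refine le_max_of_le_left ?_
    change (runSelect θ (P.eval D)).1.length ≤ _
    omega
  | project X P =>
    have h1 := (runProject_bounds X (P.eval D) ∅).2.2
    have h2 : (project X P).time D = P.time D + (runProject X ∅ (P.eval D)).2 + 1 := rfl
    refine le_max_of_le_left ?_
    change (runProject X ∅ (P.eval D)).1.length ≤ _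
    omega
  | hproject X E P => exact hs.elim
  | join on P Q =>
    have h1 := runJoin_snd on (P.eval D) (Q.eval D)
    have h2 : (join on P Q).time D =
      P.time D + Q.time D + (runJoin on (P.eval D) (Q.eval D)).2 + 1 := rfl
    refine le_max_of_le_left ?_
    change (runJoin on (P.eval D) (Q.eval D)).1.length ≤ _
    omega

theorem one_le_time (P : Plan Rel ar V A) : 1 ≤ P.time D := by
  cases P <;> simp [time, run]

/-- With `K` the product of the two powers and `m` the maximum, the pushed plan takes at most `12 *
K * m` steps. The last projection adds at most `4 * K * m` and one step of overhead. -/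
theorem time_project_pushIneqs_le [Fintype Rel] {J : Finset (A × A)} {W : Finset A}
    (hW : ∀ e ∈ J, e.1 ∈ W ∧ e.2 ∈ W) {P : Plan Rel ar V A} (hs : P.IsSPJ) (h : P.WellFormed)
    (X : Finset A) : (project X (pushIneqs J P)).time D ≤
      18 * ((W.card + 1) ^ W.card * (W.card ^ 2 + 1) ^ (W.card + 1)) *
        max (P.time D) D.size := by
  have h1 := time_pushIneqs_le D hW hs h
  have h2 := length_eval_pushIneqs_le D hW hs h
  have h3 := (runProject_bounds X ((pushIneqs J P).eval D) ∅).1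
  have h4 : (project X (pushIneqs J P)).time D = (pushIneqs J P).time D +
    (runProject X ∅ ((pushIneqs J P).eval D)).2 + 1 := rfl
  have h5 := length_eval_le D hs
  have h6 := one_le_time D P
  have h7 : P.time D ≤ max (P.time D) D.size := le_max_left _ _
  have hc : 1 ≤ (W.card + 1) ^ W.card := Nat.one_le_pow _ _ (by simp)
  have hN : 1 ≤ (W.card ^ 2 + 1) ^ (W.card + 1) := Nat.one_le_pow _ _ (by simp)
  generalize (W.card + 1) ^ W.card = c at *
  generalize (W.card ^ 2 + 1) ^ (W.card + 1) = N at *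
  generalize max (P.time D) D.size = m at *
  have hcN : c ≤ c * N := Nat.le_mul_of_pos_right _ hN
  generalize c * N = K at *
  have h8 : c * (P.eval D).length ≤ K * m := Nat.mul_le_mul hcN h5
  have h9 : 6 * K * (P.time D + (P.eval D).length) ≤ 6 * K * (2 * m) :=
    Nat.mul_le_mul_left _ (by omega)
  have h10 : 1 ≤ K * m := Nat.mul_pos (by omega) (by omega)
  rw [h4]
  nlinarith

end Cost

end Plan

/-! ### The asymptotics of the bound -/

/-- For `k ≥ 2` the logarithm is at most `5 * log k + (3 * k) * (3 * log k)`, whence 14 = 5 + 9; the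
division by `log 2` changes the base. -/
theorem isBigO_logb_size_bound :
    (fun k : ℕ => Real.logb 2 (18 * ((k : ℝ) ^ 2 + 1) ^ (2 * k + 1))) =O[atTop]
      (fun k : ℕ => (k : ℝ) * Real.log k) := by
  refine IsBigO.of_bound (14 / Real.log 2) ?_
  filter_upwards [eventually_ge_atTop 2] with k hk
  have hk' : (2 : ℝ) ≤ k := by exact_mod_cast hk
  have hlog2 : 0 < Real.log 2 := Real.log_pos one_lt_two
  have hlog : 0 ≤ Real.log k := Real.log_nonneg (by linarith)
  have h1 : Real.log ((k : ℝ) ^ 2 + 1) ≤ 3 * Real.log k := by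
    rw [show 3 * Real.log k = Real.log ((k : ℝ) ^ 3) by rw [Real.log_pow]; norm_num]
    exact Real.log_le_log (by positivity) (by nlinarith [sq_nonneg (k : ℝ)])
  have h2 : Real.log 18 ≤ 5 * Real.log k := by
    rw [show 5 * Real.log k = Real.log ((k : ℝ) ^ 5) by rw [Real.log_pow]; norm_num]
    refine Real.log_le_log (by norm_num) ?_
    calc (18 : ℝ) ≤ 2 ^ 5 := by norm_num
      _ ≤ (k : ℝ) ^ 5 := by gcongr
  have h3 : Real.log (18 * ((k : ℝ) ^ 2 + 1) ^ (2 * k + 1)) ≤ 14 * (k * Real.log k) := by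
    rw [Real.log_mul (by norm_num) (by positivity), Real.log_pow]
    push_cast
    have h4 : (2 * (k : ℝ) + 1) * Real.log ((k : ℝ) ^ 2 + 1) ≤ (3 * k) * (3 * Real.log k) :=
      mul_le_mul (by linarith) h1 (Real.log_nonneg (by nlinarith)) (by positivity)
    nlinarith
  have h5 : 0 ≤ Real.log (18 * ((k : ℝ) ^ 2 + 1) ^ (2 * k + 1)) := by
    refine Real.log_nonneg ?_
    have : (1 : ℝ) ≤ ((k : ℝ) ^ 2 + 1) ^ (2 * k + 1) := one_le_pow₀ (by nlinarith)
    linarith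
  rw [Real.logb, Real.norm_of_nonneg (div_nonneg h5 hlog2.le),
    Real.norm_of_nonneg (by positivity), div_mul_eq_mul_div]
  gcongr

/-! ### Correctness and cost for a query with inequalities -/

namespace Plan

variable {Rel : Type u} {ar : Rel → ℕ} {V : Type v} {Var : Type w} {A : Type x}

theorem wellFormed_transform {P : Plan Rel ar V A} {ρ : Var → A} {q : CQ Rel ar V Var}
    (I : Finset (Var × Var)) (h : P.IsSPJPlanFor ρ q) : (P.transform ρ q I).WellFormed := by
  classical
  refine ⟨wellFormed_pushIneqs _ h.spj h.wellFormed, ?_⟩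
  rw [atts_pushIneqs]
  refine subset_trans ?_ (atts_subset_leafAtts h.wellFormed)
  rw [h.computes.1]

theorem computes_transform {P : Plan Rel ar V A} {ρ : Var → A} {q : CQ Rel ar V Var}
    {I : Finset (Var × Var)} (hI : ∀ p ∈ I, p.1 ∈ q.vars ∧ p.2 ∈ q.vars)
    (h : P.IsSPJPlanFor ρ q) : (P.transform ρ q I).Computes ρ q I := by
  classical
  refine ⟨rfl, fun D => ?_⟩
  have hhead : ∀ y ∈ q.head, y ∈ q.vars := q.safe
  have hread : ∀ t : Tup V A, readVars ρ q.head (t.restrict (q.head.image ρ)) =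
      readVars ρ (q.head : Set Var) t := by
    intro t
    funext y
    by_cases hy : y ∈ q.head
    · simp [readVars, hy, Tup.restrict_apply_of_mem (Finset.mem_image_of_mem ρ hy) t]
    · simp [readVars, hy]
  have hhd : ∀ t : Tup V A, (readVars ρ (q.head : Set Var) t) =
      fun y => if y ∈ q.head then readVars ρ q.vars t y else none := by
    intro t
    funext y
    by_cases hy : y ∈ q.head
    · simp [readVars, hy, hhead y hy]
    · simp [readVars, hy]
  ext g
  constructor
  · rintro ⟨u, hu, rfl⟩
    obtain ⟨t, ht, rfl⟩ := (mem_eval_project D).1 hu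
    obtain ⟨h1, h2⟩ := mem_dropProj_of_mem_eval_pushIneqs D _ h.spj h.wellFormed t ht
    have h3 : readVars ρ q.vars t ∈ q.fullAnswers D := h.full D ▸ ⟨t, h1, rfl⟩
    refine ⟨_, h3, fun p hp => ?_, ?_⟩
    · have := h2 (ρ p.1, ρ p.2) (Finset.mem_image_of_mem _ hp) (h.mem_leafAtts _ (hI p hp).1)
        (h.mem_leafAtts _ (hI p hp).2)
      simpa only [readVars, (hI p hp).1, (hI p hp).2, if_true] using this
    · rw [hread, hhd]
  · rintro ⟨s, hs, hne, rfl⟩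
    rw [← h.full D] at hs
    obtain ⟨t, ht, rfl⟩ := hs
    obtain ⟨t', ht', h1, -⟩ := exists_mem_eval_pushIneqs D (I.image fun p => (ρ p.1, ρ p.2))
      h.spj h.wellFormed t ht
      (fun e he _ _ => by
        obtain ⟨p, hp, rfl⟩ := Finset.mem_image.1 he
        have := hne p hp
        simpa only [readVars, (hI p hp).1, (hI p hp).2, if_true] using this)
      -- At the top nothing lies outside, so any `v` would do; with `none` the crossing condition
      -- follows from the support of `t`.
      (fun _ => none)
      (fun e he h1 _ =>
        ((hasSupport_of_mem_eval_dropProj D h.wellFormed t ht) _).2 h1)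
    refine ⟨t'.restrict (q.head.image ρ), (mem_eval_project D).2 ⟨t', ht', rfl⟩, ?_⟩
    rw [hread, ← hhd]
    funext y
    by_cases hy : y ∈ q.head
    · have : ρ y ∈ P.atts := by
        rw [h.computes.1]
        convert Finset.mem_image_of_mem ρ hy
      simp [readVars, hy, h1 _ this]
    · simp [readVars, hy]

theorem time_transform_le [Fintype Rel] {P : Plan Rel ar V A} {ρ : Var → A}
    {q : CQ Rel ar V Var} (I : Finset (Var × Var)) (h : P.IsSPJPlanFor ρ q)
    (D : Database Rel ar V) : (P.transform ρ q I).time D ≤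
      18 * (numIneqVars I ^ 2 + 1) ^ (2 * numIneqVars I + 1) * max (P.time D) D.size := by
  classical
  have hW : ∀ e ∈ I.image fun p => (ρ p.1, ρ p.2),
      e.1 ∈ (I.image Prod.fst ∪ I.image Prod.snd).image ρ ∧
      e.2 ∈ (I.image Prod.fst ∪ I.image Prod.snd).image ρ := by
    intro e he
    obtain ⟨p, hp, rfl⟩ := Finset.mem_image.1 he
    exact ⟨Finset.mem_image_of_mem _ (Finset.mem_union_left _ (Finset.mem_image_of_mem _ hp)),
      Finset.mem_image_of_mem _ (Finset.mem_union_right _ (Finset.mem_image_of_mem _ hp))⟩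
  have hk : ((I.image Prod.fst ∪ I.image Prod.snd).image ρ).card ≤ numIneqVars I := by
    rw [numIneqVars]
    exact Finset.card_image_le
  refine (time_project_pushIneqs_le D hW h.spj h.wellFormed _).trans (Nat.mul_le_mul_right _ ?_)
  generalize ((I.image Prod.fst ∪ I.image Prod.snd).image ρ).card = m at *
  generalize numIneqVars I = k at *
  refine Nat.mul_le_mul_left _ ?_
  -- Both powers are brought to the common base `k ^ 2 + 1`. Only `m ≤ k` holds, since variables may
  -- share an attribute.
  have h1 : m + 1 ≤ k ^ 2 + 1 := by nlinarith [Nat.le_self_pow two_ne_zero k]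
  have h2 : m ^ 2 + 1 ≤ k ^ 2 + 1 := by gcongr
  calc (m + 1) ^ m * (m ^ 2 + 1) ^ (m + 1)
      ≤ (k ^ 2 + 1) ^ m * (k ^ 2 + 1) ^ (m + 1) := by gcongr
    _ ≤ (k ^ 2 + 1) ^ k * (k ^ 2 + 1) ^ (k + 1) := by gcongr <;> simp
    _ = (k ^ 2 + 1) ^ (2 * k + 1) := by rw [← pow_add]; ring_nf

end Plan

theorem theorem2 :
    ∃ f : ℕ → ℝ, f =O[atTop] (fun k : ℕ => (k : ℝ) * Real.log k) ∧
      ∀ (Rel : Type u) [Fintype Rel] (ar : Rel → ℕ) (V : Type v) (Var : Type w),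
        ∃ g : CQ Rel ar V Var → Finset (Var × Var) → ℝ,
          (∀ q I, g q I ≤ (2 : ℝ) ^ f (numIneqVars I)) ∧
          ∀ (A : Type x) (q : CQ Rel ar V Var) (I : Finset (Var × Var)),
            (∀ p ∈ I, p.1 ∈ q.vars ∧ p.2 ∈ q.vars) →
            ∀ (P : Plan Rel ar V A) (ρ : Var → A), P.IsSPJPlanFor ρ q →
              (P.transform ρ q I).WellFormed ∧
              (P.transform ρ q I).Computes ρ q I ∧
              ∀ T : ℕ → ℕ → ℝ,
                (∀ D : Database Rel ar V, (P.time D : ℝ) ≤ T q.size D.size) →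
                ∀ D : Database Rel ar V,
                  ((P.transform ρ q I).time D : ℝ) ≤
                    g q I * max (T q.size D.size) (D.size : ℝ) := by
  -- The exponent is the exact binary logarithm of the bound, so `g` equals `2 ^ f` for every `k`,
  -- small values included.
  refine ⟨fun k => Real.logb 2 (18 * ((k : ℝ) ^ 2 + 1) ^ (2 * k + 1)), isBigO_logb_size_bound, ?_⟩
  intro Rel _ ar V Var
  refine ⟨fun _ I => 18 * ((numIneqVars I : ℝ) ^ 2 + 1) ^ (2 * numIneqVars I + 1), ?_, ?_⟩
  · intro q I
    rw [Real.rpow_logb two_pos (by norm_num) (by positivity)]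
  · intro A q I hI P ρ h
    refine ⟨Plan.wellFormed_transform I h, Plan.computes_transform hI h, fun T hT D => ?_⟩
    have h1 : ((P.transform ρ q I).time D : ℝ) ≤
        18 * ((numIneqVars I : ℝ) ^ 2 + 1) ^ (2 * numIneqVars I + 1) *
          max (P.time D : ℝ) (D.size : ℝ) := by
      exact_mod_cast Plan.time_transform_le I h D
    refine h1.trans (mul_le_mul_of_nonneg_left (max_le_max (hT D) le_rfl) (by positivity))
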